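/- Let $H_n=\sum_{0<j\le n}\frac1j$ denote the $n$-th harmonic number ($H_0=0$), let $G=\sum_{k=0}^\infty\frac{(-1)^k}{(2k+1)^2}$ be Catalan's constant, and let $Q(k)=(2k-1)(11k-3)=22k^2-17k+3$. Then the following three series converge (absolutely) and have the stated sums: $$\sum_{k=1}^\infty \frac{16^k \binom{4k}{2k} \left( Q(k) H_{k-1} + \frac{(6k-1)(4k-3)}{2k-1} \right) }{k (4k-1)(4k-3)\binom{3k}{k} \binom{6k}{3k}} = 16G - 4 \pi \log 2,$$ $$\sum_{k=1}^\infty \frac{16^k \binom{4k}{2k} \left( Q(k) H_{2k-1} + \frac{(6k-1)(k-3)}{6k-3} \right) }{k (4k-1)(4k-3)\binom{3k}{k} \binom{6k}{3k}} = \frac{4}{3} (8G - \pi \log 2),$$ $$\sum_{k=1}^\infty \frac{16^k \binom{4k}{2k} \left( Q(k) (2H_{6k-1}-H_{3k-1})+ \frac{4(18k^2-20k+3)}{6k-3} \right) }{k (4k-1)(4k-3)\binom{3k}{k} \binom{6k}{3k}} = \frac{4}{3} (16G + \pi \log 2).$$ -/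

import Mathlib

/-- Catalan's constant `G = ∑_{k ≥ 0} (-1)^k / (2k+1)^2` (an absolutely convergent series). -/
noncomputable def catalanConstant : ℝ :=
  ∑' k : ℕ, (-1 : ℝ) ^ k / (2 * (k : ℝ) + 1) ^ 2

/-- The quadratic polynomial `Q(k) = (2k-1)(11k-3)`. -/
def polyQ (k : ℝ) : ℝ := (2 * k - 1) * (11 * k - 3)

theorem polyQ_eq (k : ℝ) : polyQ k = 22 * k ^ 2 - 17 * k + 3 := by
  unfold polyQ; ring

/-! The proof is a Wilf–Zeilberger acceleration of slowly convergent alternating series. With `F =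
accelTerm` and `G j m = -m/(2m-2j-1) * accelTerm j m`, one has `F j m - F (j+1) m = G j (m+1) - G j
m`. Row 0 of `F` is the Leibniz series. Moving down two rows for each column turns its sum into a
sum over the diagonal `(2k, k)`, whose terms decay geometrically. The rational factor picked up
there is `1 - (k+1)/(6k+3) - 2(4k+1)(k+1)/((6k+3)(6k+5))`, with numerator `(2k+1)(11k+8) = Q(k+1)`;
this is the origin of `Q`.

The identity survives multiplication of `F` by certain weights made of harmonic sums, provided `G`
is corrected accordingly (`IsPerturbation`). Three such weights are used (`isPerturbation_odd`,
`isPerturbation_mixed`, `isPerturbation_window`), and `IsPerturbation.tendsto_sub` shows that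
acceleration preserves the value of each.

The row 0 sums reduce to `∑ (-1)^n H_n/(2n+1)` and `∑ (-1)^n O_{n+1}/(2n+1)`, where `O_n = ∑_{i<n}
1/(2i+1)`. Generating functions turn these into integrals over [0,1], which are evaluated from `∫
log x/(1+x²) = -G` (Catalan's constant) and the integral of `log sin`. On the diagonal,
`choose_quotient_eq` identifies `accelTerm` with the binomial quotient, and the three stated series
are linear combinations of the three accelerated ones. -/

/-! ### The accelerating array

`accelTerm j m = (-1)^(m+j) (2j)! / ∏_{|i| ≤ j} (2m+1+2i)`; up to a power of two these are the
central differences of `1/(2m+1)`, with alternating signs. -/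

/-- The array `(-1)^(m+j) (2j)! / ∏_{|i| ≤ j} (2m+1+2i)`, defined by recursion on `j`. -/
noncomputable def accelTerm : ℕ → ℕ → ℝ
  | 0, m => (-1) ^ m / (2 * (m : ℝ) + 1)
  | j + 1, m => -(accelTerm j m * ((2 * (j : ℝ) + 1) * (2 * j + 2)) /
      ((2 * (m : ℝ) - 2 * j - 1) * (2 * m + 2 * j + 3)))

/-- The odd harmonic number `∑_{i < n} 1/(2i+1)`. -/
noncomputable def oddHarmonic (n : ℕ) : ℝ := ∑ i ∈ Finset.range n, 1 / (2 * (i : ℝ) + 1)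

/-- The sum of `2/(2i+1)` over the window `m - j ≤ i ≤ m` of integers. -/
noncomputable def oddWindow (j m : ℕ) : ℝ :=
  ∑ i ∈ Finset.range (j + 1), 2 / (2 * ((m : ℝ) - i) + 1)

/-! ### Odd denominators and recurrences of the array -/

theorem one_le_abs_odd (m j : ℕ) : 1 ≤ |2 * (m : ℝ) - 2 * j - 1| := by
  have h : (2 * (m : ℤ) - 2 * j - 1) ≠ 0 := by omega
  have := Int.one_le_abs h
  exact_mod_cast this

/-- Parity keeps every denominator away from zero, also in the columns `m ≤ j`. This matters because
the diagonal `j = 2k`, `m = k` lies in that region. -/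
theorem odd_ne_zero (m j : ℕ) : 2 * (m : ℝ) - 2 * j - 1 ≠ 0 := by
  intro h
  have := one_le_abs_odd m j
  rw [h] at this
  norm_num at this

theorem odd_ne_zero' (m j : ℕ) : 2 * (m : ℝ) + 1 - 2 * j ≠ 0 := by
  have := odd_ne_zero (m + 1) j
  push_cast at this
  convert this using 1; ring

theorem odd_factored_ne_zero (m j : ℕ) :
    2 * ((m : ℝ) - j) - 1 ≠ 0 ∧ 2 * ((m : ℝ) + 1 - j) - 1 ≠ 0 ∧ 2 * ((m : ℝ) - j) + 1 ≠ 0 := by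
  have h1 := odd_ne_zero m j
  have h2 := odd_ne_zero' m j
  refine ⟨?_, ?_, ?_⟩
  · convert h1 using 1; ring
  · convert h2 using 1; ring
  · convert h2 using 1; ring

theorem accelTerm_succ_left (j m : ℕ) :
    accelTerm (j + 1) m = -(accelTerm j m * ((2 * (j : ℝ) + 1) * (2 * j + 2)) /
      ((2 * (m : ℝ) - 2 * j - 1) * (2 * m + 2 * j + 3))) := rfl

theorem accelTerm_succ_right (j m : ℕ) :
    accelTerm j (m + 1) =
      -(accelTerm j m * (2 * (m : ℝ) + 1 - 2 * j) / (2 * (m : ℝ) + 3 + 2 * j)) := by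
  induction j with
  | zero =>
    simp only [accelTerm]
    push_cast
    have h1 : 2 * (m : ℝ) + 1 ≠ 0 := by positivity
    have h2 : 2 * (m : ℝ) + 3 ≠ 0 := by positivity
    have h3 : 2 * ((m : ℝ) + 1) + 1 ≠ 0 := by positivity
    field_simp
    ring
  | succ j ih =>
    rw [accelTerm_succ_left, accelTerm_succ_left, ih]
    obtain ⟨h1, h2, -⟩ := odd_factored_ne_zero m j
    have h3 : 2 * (m : ℝ) + 3 + 2 * j ≠ 0 := by positivity
    have h4 : 2 * (m : ℝ) + 3 + 2 * (j + 1) ≠ 0 := by positivity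
    have h5 : 2 * (m : ℝ) + 2 * j + 3 ≠ 0 := by positivity
    have h6 : 2 * ((m : ℝ) + 1) + 2 * j + 3 ≠ 0 := by positivity
    push_cast
    field_simp
    ring

theorem oddHarmonic_succ (n : ℕ) : oddHarmonic (n + 1) = oddHarmonic n + 1 / (2 * (n : ℝ) + 1) := by
  simp [oddHarmonic, Finset.sum_range_succ]

theorem harmonic_succ_real (n : ℕ) :
    (harmonic (n + 1) : ℝ) = (harmonic n : ℝ) + 1 / ((n : ℝ) + 1) := by
  rw [harmonic_succ]; push_cast; simp

theorem oddWindow_succ_left (j m : ℕ) :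
    oddWindow (j + 1) m = oddWindow j m + 2 / (2 * (m : ℝ) - 2 * j - 1) := by
  rw [oddWindow, Finset.sum_range_succ, ← oddWindow]
  push_cast
  congr 2
  ring

theorem oddWindow_succ_right (j m : ℕ) :
    oddWindow j (m + 1) =
      oddWindow j m + 2 / (2 * (m : ℝ) + 3) - 2 / (2 * (m : ℝ) + 1 - 2 * j) := by
  induction j with
  | zero =>
    simp only [oddWindow, zero_add, Finset.sum_range_one]
    push_cast
    have h2 : 2 * (m : ℝ) + 3 ≠ 0 := by positivity
    have h3 : 2 * ((m : ℝ) + 1 - 0) + 1 ≠ 0 := by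
      have : 2 * ((m : ℝ) + 1 - 0) + 1 = 2 * m + 3 := by ring
      rwa [this]
    have h1 : 2 * (m : ℝ) + 1 ≠ 0 := by positivity
    have h4 : 2 * ((m : ℝ) - 0) + 1 ≠ 0 := by simpa using h1
    simp only [mul_zero, sub_zero] at *
    field_simp
    ring
  | succ j ih =>
    rw [oddWindow_succ_left, oddWindow_succ_left, ih]
    have h1 := odd_ne_zero m j
    have e1 : 2 * ((m + 1 : ℕ) : ℝ) - 2 * j - 1 = 2 * m + 1 - 2 * j := by push_cast; ring
    have e2 : 2 * (m : ℝ) + 1 - 2 * ((j + 1 : ℕ) : ℝ) = 2 * m - 2 * j - 1 := by push_cast; ring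
    rw [e1, e2]
    ring

/-- A perturbation of `accelTerm`, written as a relative weight `h`, for which consecutive rows
still differ by a telescoping sequence; `p` and `s` give the weight of the certificate. -/
structure IsPerturbation (h p s : ℕ → ℕ → ℝ) : Prop where
  telescope : ∀ j m : ℕ,
    accelTerm j m * h j m - accelTerm (j + 1) m * h (j + 1) m =
      accelTerm j (m + 1) * (-((m + 1 : ℕ) : ℝ) / (2 * ((m + 1 : ℕ) : ℝ) - 2 * j - 1) *
        (h j (m + 1) + p j (m + 1)) + s j (m + 1)) -
      accelTerm j m * (-(m : ℝ) / (2 * (m : ℝ) - 2 * j - 1) * (h j m + p j m) + s j m)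
  abs_weight_le : ∀ j m : ℕ, |h j m| ≤ 8 * ((harmonic m : ℝ) + j + 1)
  abs_shift_le : ∀ j m : ℕ, |p j m| ≤ 3
  abs_corr_le : ∀ j m : ℕ, |s j m| ≤ 1

/-! ### Size of harmonic sums and windows -/

theorem harmonic_nonneg_real (n : ℕ) : 0 ≤ (harmonic n : ℝ) := by
  induction n with
  | zero => simp
  | succ n ih => rw [harmonic_succ_real]; positivity

theorem harmonic_le_self (n : ℕ) : (harmonic n : ℝ) ≤ n := by
  induction n with
  | zero => simp
  | succ n ih =>
    rw [harmonic_succ_real]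
    have : 1 / ((n : ℝ) + 1) ≤ 1 := by
      rw [div_le_one (by positivity)]; linarith [Nat.cast_nonneg (α := ℝ) n]
    push_cast; linarith

theorem oddHarmonic_nonneg (n : ℕ) : 0 ≤ oddHarmonic n :=
  Finset.sum_nonneg fun i _ => by positivity

theorem oddHarmonic_le_harmonic (n : ℕ) : oddHarmonic n ≤ (harmonic n : ℝ) := by
  induction n with
  | zero => simp [oddHarmonic]
  | succ n ih =>
    rw [harmonic_succ_real, oddHarmonic_succ]
    have : 1 / (2 * (n : ℝ) + 1) ≤ 1 / ((n : ℝ) + 1) :=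
      one_div_le_one_div_of_le (by positivity) (by linarith [Nat.cast_nonneg (α := ℝ) n])
    linarith

theorem oddHarmonic_add_le (m j : ℕ) : oddHarmonic (m + j) ≤ (harmonic m : ℝ) + j := by
  induction j with
  | zero => simpa using oddHarmonic_le_harmonic m
  | succ j ih =>
    rw [← add_assoc, oddHarmonic_succ]
    have : 1 / (2 * ((m + j : ℕ) : ℝ) + 1) ≤ 1 := by
      rw [div_le_one (by positivity)]; linarith [Nat.cast_nonneg (α := ℝ) (m + j)]
    push_cast at this ⊢; linarith

theorem abs_oddWindow_le (j m : ℕ) : |oddWindow j m| ≤ 2 * ((j : ℝ) + 1) := by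
  have hb : ∀ i ∈ Finset.range (j + 1), |2 / (2 * ((m : ℝ) - i) + 1)| ≤ 2 := by
    intro i _
    have := one_le_abs_odd (m + 1) i
    push_cast at this
    rw [show 2 * ((m : ℝ) + 1) - 2 * i - 1 = 2 * ((m : ℝ) - i) + 1 by ring] at this
    rw [abs_div, abs_two]
    exact div_le_self (by norm_num) this
  calc |oddWindow j m| ≤ ∑ i ∈ Finset.range (j + 1), |2 / (2 * ((m : ℝ) - i) + 1)| :=
        Finset.abs_sum_le_sum_abs _ _
    _ ≤ ∑ i ∈ Finset.range (j + 1), (2 : ℝ) := Finset.sum_le_sum hb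
    _ = 2 * ((j : ℝ) + 1) := by simp; ring

/-! ### The three perturbations -/

theorem inv_odd_mem (m : ℕ) : 0 < 1 / (2 * (m : ℝ) + 1) ∧ 1 / (2 * (m : ℝ) + 1) ≤ 1 := by
  refine ⟨by positivity, ?_⟩
  rw [div_le_one (by positivity)]; linarith [Nat.cast_nonneg (α := ℝ) m]

/-- Once the one-step recurrences are inserted, the coefficient of each harmonic sum is the
unweighted identity (`h = 1`, `p = s = 0`). What remains, coming from the increments of the weight,
is an identity of rational functions. The other two perturbations are verified in the same way. -/
theorem isPerturbation_odd :
    IsPerturbation (fun j m => 4 * oddHarmonic m + 2 * (1 / (2 * (m : ℝ) + 1)) - harmonic j)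
      (fun _ m => -2 * (1 / (2 * (m : ℝ) + 1))) (fun _ _ => 0) where
  telescope j m := by
    rw [accelTerm_succ_left, accelTerm_succ_right, oddHarmonic_succ, harmonic_succ_real]
    obtain ⟨h1, h2, h2'⟩ := odd_factored_ne_zero m j
    have h3 : 2 * (m : ℝ) + 1 ≠ 0 := by positivity
    have h4 : 2 * (m : ℝ) + 3 + 2 * j ≠ 0 := by positivity
    have h5 : 2 * (m : ℝ) + 2 * j + 3 ≠ 0 := by positivity
    have h6 : 2 * ((m : ℝ) + 1) + 1 ≠ 0 := by positivity
    have h7 : (j : ℝ) + 1 ≠ 0 := by positivity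
    push_cast
    generalize oddHarmonic m = x
    generalize (harmonic j : ℝ) = y
    generalize accelTerm j m = z
    field_simp
    ring
  abs_weight_le j m := by
    have := inv_odd_mem m
    have := oddHarmonic_le_harmonic m
    have := oddHarmonic_nonneg m
    have := harmonic_nonneg_real j
    have := harmonic_le_self j
    have := harmonic_nonneg_real m
    rw [abs_le]; constructor <;> linarith
  abs_shift_le j m := by
    have := inv_odd_mem m
    rw [abs_le]; constructor <;> linarith
  abs_corr_le j m := by simp

/-- On the diagonal `m + j = 3k`, so this weight supplies the odd harmonic numbers of index near
`3k` behind `2H_{6k-1} - H_{3k-1}`. -/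
theorem isPerturbation_mixed :
    IsPerturbation (fun j m => 1 / (2 * (m : ℝ) + 1) + harmonic m + harmonic j
        - 2 * oddHarmonic (m + j + 1) - 2 * oddHarmonic (m + 1))
      (fun _ m => 1 / (2 * (m : ℝ) + 1)) (fun _ _ => 0) where
  telescope j m := by
    have e1 : m + 1 + j + 1 = (m + j + 1) + 1 := by ring
    have e2 : m + (j + 1) + 1 = (m + j + 1) + 1 := by ring
    simp only [e1, e2]
    rw [accelTerm_succ_left, accelTerm_succ_right, oddHarmonic_succ (m + 1),
      oddHarmonic_succ (m + j + 1), harmonic_succ_real, harmonic_succ_real]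
    obtain ⟨h1, h2, h2'⟩ := odd_factored_ne_zero m j
    have h3 : 2 * (m : ℝ) + 1 ≠ 0 := by positivity
    have h4 : 2 * (m : ℝ) + 3 + 2 * j ≠ 0 := by positivity
    have h5 : 2 * (m : ℝ) + 2 * j + 3 ≠ 0 := by positivity
    have h6 : 2 * ((m : ℝ) + 1) + 1 ≠ 0 := by positivity
    have h7 : (j : ℝ) + 1 ≠ 0 := by positivity
    have h8 : (m : ℝ) + 1 ≠ 0 := by positivity
    have h9 : 2 * ((m : ℝ) + j + 1) + 1 ≠ 0 := by positivity
    push_cast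
    generalize oddHarmonic (m + 1) = x
    generalize oddHarmonic (m + j + 1) = x'
    generalize (harmonic j : ℝ) = y
    generalize (harmonic m : ℝ) = y'
    generalize accelTerm j m = z
    field_simp
    ring
  abs_weight_le j m := by
    have := inv_odd_mem m
    have h1 := oddHarmonic_add_le m (j + 1)
    have h2 := oddHarmonic_add_le m 1
    have h3 := oddHarmonic_nonneg (m + (j + 1))
    have h4 := oddHarmonic_nonneg (m + 1)
    have := harmonic_nonneg_real j
    have := harmonic_le_self j
    have := harmonic_nonneg_real m
    rw [← add_assoc] at h1 h3
    push_cast at h1 h2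
    rw [abs_le]; constructor <;> linarith
  abs_shift_le j m := by
    have := inv_odd_mem m
    rw [abs_le]; constructor <;> linarith
  abs_corr_le j m := by simp

/-- This weight isolates `H_k`, because the window collapses on the diagonal (`oddWindow_diagonal`).
The term `s` carries the value of the certificate at `m = 0`, where the factor `-m/(2m-2j-1)`
annihilates everything else. -/
theorem isPerturbation_window :
    IsPerturbation (fun j m => harmonic m - 1 / (2 * (m : ℝ) + 1) + oddWindow j m)
      (fun j m => -(1 / (2 * (m : ℝ) + 1)) + 2 * (1 / (2 * (m : ℝ) - 2 * j - 1)))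
      (fun j m => 1 / (2 * (m : ℝ) - 2 * j - 1)) where
  telescope j m := by
    rw [accelTerm_succ_left, accelTerm_succ_right, oddWindow_succ_left, oddWindow_succ_right,
      harmonic_succ_real]
    obtain ⟨h1, h2, h2'⟩ := odd_factored_ne_zero m j
    have h3 : 2 * (m : ℝ) + 1 ≠ 0 := by positivity
    have h4 : 2 * (m : ℝ) + 3 + 2 * j ≠ 0 := by positivity
    have h5 : 2 * (m : ℝ) + 2 * j + 3 ≠ 0 := by positivity
    have h6 : 2 * ((m : ℝ) + 1) + 1 ≠ 0 := by positivity
    have h7 : (j : ℝ) + 1 ≠ 0 := by positivity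
    have h8 : (m : ℝ) + 1 ≠ 0 := by positivity
    have h9 : 2 * (m : ℝ) + 3 ≠ 0 := by positivity
    have e1 : 2 * ((m : ℝ) + 1) - 2 * j - 1 = 2 * m - 2 * j + 1 := by ring
    have e2 : 2 * ((m : ℝ) + 1) + 1 = 2 * m + 3 := by ring
    have e3 : 2 * (m : ℝ) + 2 * j + 3 = 2 * m + 3 + 2 * j := by ring
    have e4 : 2 * (m : ℝ) + 1 - 2 * j = 2 * m - 2 * j + 1 := by ring
    push_cast
    rw [e1, e2, e3, e4]
    generalize oddWindow j m = x
    generalize (harmonic m : ℝ) = y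
    generalize accelTerm j m = z
    field_simp
    ring
  abs_weight_le j m := by
    have := inv_odd_mem m
    have := abs_le.mp (abs_oddWindow_le j m)
    have := harmonic_nonneg_real m
    have := Nat.cast_nonneg (α := ℝ) j
    rw [abs_le]; constructor <;> linarith
  abs_shift_le j m := by
    have := inv_odd_mem m
    have h : |1 / (2 * (m : ℝ) - 2 * j - 1)| ≤ 1 := by
      rw [abs_div, abs_one]
      exact div_le_self zero_le_one (one_le_abs_odd m j)
    have := abs_le.mp h
    rw [abs_le]; constructor <;> linarith
  abs_corr_le j m := by
    rw [abs_div, abs_one]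
    exact div_le_self zero_le_one (one_le_abs_odd m j)

/-- The telescoping certificate of a perturbation. -/
noncomputable def perturbCert (h p s : ℕ → ℕ → ℝ) (j m : ℕ) : ℝ :=
  accelTerm j m * (-(m : ℝ) / (2 * (m : ℝ) - 2 * j - 1) * (h j m + p j m) + s j m)

/-- The `k`-th term of the accelerated series of a perturbation. -/
noncomputable def accelSeries (h p s : ℕ → ℕ → ℝ) (k : ℕ) : ℝ :=
  accelTerm (2 * k) k * h (2 * k) k - perturbCert h p s (2 * k) (k + 1)
    - perturbCert h p s (2 * k + 1) (k + 1)

/-- Induction on `K`: the entry of row `2K` in column `K` is split off, and the remaining columns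
pass to row `2K + 2` by two applications of the telescoping relation. The boundary values at column
`K + 1` join the diagonal term; those at column `N` are error terms. -/
theorem sum_eq_sum_diagonal {F G : ℕ → ℕ → ℝ}
    (hFG : ∀ j m, F j m - F (j + 1) m = G j (m + 1) - G j m) (N : ℕ) {K : ℕ} (hK : K ≤ N) :
    ∑ m ∈ Finset.range N, F 0 m =
      ∑ k ∈ Finset.range K, (F (2 * k) k - G (2 * k) (k + 1) - G (2 * k + 1) (k + 1)) +
      ∑ k ∈ Finset.range K, (G (2 * k) N + G (2 * k + 1) N) +
      ∑ m ∈ Finset.Ico K N, F (2 * K) m := by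
  induction K with
  | zero => simp
  | succ K ih =>
    rw [ih (by omega), Finset.sum_range_succ, Finset.sum_range_succ,
      Finset.sum_eq_sum_Ico_succ_bot (by omega : K < N)]
    have key : ∑ m ∈ Finset.Ico (K + 1) N, F (2 * K) m - ∑ m ∈ Finset.Ico (K + 1) N, F (2 * (K + 1)) m
        = (G (2 * K) N + G (2 * K + 1) N) - (G (2 * K) (K + 1) + G (2 * K + 1) (K + 1)) := by
      rw [← Finset.sum_sub_distrib]
      have : ∀ m ∈ Finset.Ico (K + 1) N, F (2 * K) m - F (2 * (K + 1)) m =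
          (G (2 * K) (m + 1) + G (2 * K + 1) (m + 1)) - (G (2 * K) m + G (2 * K + 1) m) := by
        intro m _
        have h1 := hFG (2 * K) m
        have h2 := hFG (2 * K + 1) m
        rw [show 2 * (K + 1) = 2 * K + 1 + 1 by ring]
        linarith
      rw [Finset.sum_congr rfl this]
      exact Finset.sum_Ico_sub (fun m => G (2 * K) m + G (2 * K + 1) m) hK
    linarith

/-! ### Decay of the array -/

theorem abs_accelTerm_succ_right_le (j m : ℕ) : |accelTerm j (m + 1)| ≤ |accelTerm j m| := by
  rw [accelTerm_succ_right, abs_neg, mul_div_assoc, abs_mul]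
  refine mul_le_of_le_one_right (abs_nonneg _) ?_
  have hm := Nat.cast_nonneg (α := ℝ) m
  have hj := Nat.cast_nonneg (α := ℝ) j
  have h : 0 < 2 * (m : ℝ) + 3 + 2 * j := by positivity
  rw [abs_div, abs_of_pos h, div_le_one h, abs_le]
  constructor <;> linarith

theorem abs_accelTerm_le_of_le (j : ℕ) {m n : ℕ} (h : m ≤ n) :
    |accelTerm j n| ≤ |accelTerm j m| :=
  antitone_nat_of_succ_le (f := fun m => |accelTerm j m|) (abs_accelTerm_succ_right_le j) h

theorem accelTerm_diagonal_right (k : ℕ) : accelTerm (2 * k) (k + 1) =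
    accelTerm (2 * k) k * (2 * (k : ℝ) - 1) / (6 * k + 3) := by
  rw [accelTerm_succ_right]
  push_cast
  rw [show 2 * (k : ℝ) + 3 + 2 * (2 * k) = 6 * k + 3 by ring]
  ring

theorem accelTerm_diagonal_succ (k : ℕ) : accelTerm (2 * k + 1) (k + 1) =
    accelTerm (2 * k) k * ((4 * (k : ℝ) + 1) * (4 * k + 2)) / ((6 * k + 3) * (6 * k + 5)) := by
  rw [accelTerm_succ_left, accelTerm_diagonal_right]
  have h := odd_ne_zero' k (2 * k)
  have h1 : 2 * (k : ℝ) - 1 ≠ 0 := by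
    intro h0; apply odd_ne_zero k 0; push_cast; linarith
  push_cast at h ⊢
  have e1 : 2 * ((k : ℝ) + 1) - 2 * (2 * k) - 1 = -(2 * k - 1) := by ring
  have e2 : 2 * ((k : ℝ) + 1) + 2 * (2 * k) + 3 = 6 * k + 5 := by ring
  rw [e1, e2]
  have h2 : 6 * (k : ℝ) + 3 ≠ 0 := by positivity
  have h3 : 6 * (k : ℝ) + 5 ≠ 0 := by positivity
  field_simp
  ring

theorem accelTerm_diagonal (k : ℕ) : accelTerm (2 * (k + 1)) (k + 1) =
    accelTerm (2 * k) k * ((4 * (k : ℝ) + 1) * (4 * k + 2) * (4 * k + 3) * (4 * k + 4)) /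
      ((2 * k + 1) * (6 * k + 3) * (6 * k + 5) * (6 * k + 7)) := by
  rw [show 2 * (k + 1) = 2 * k + 1 + 1 by ring, accelTerm_succ_left, accelTerm_diagonal_succ]
  push_cast
  have e1 : 2 * ((k : ℝ) + 1) - 2 * (2 * k + 1) - 1 = -(2 * k + 1) := by ring
  have e2 : 2 * ((k : ℝ) + 1) + 2 * (2 * k + 1) + 3 = 6 * k + 7 := by ring
  rw [e1, e2]
  have h1 : 2 * (k : ℝ) + 1 ≠ 0 := by positivity
  have h2 : 6 * (k : ℝ) + 3 ≠ 0 := by positivity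
  have h3 : 6 * (k : ℝ) + 5 ≠ 0 := by positivity
  have h4 : 6 * (k : ℝ) + 7 ≠ 0 := by positivity
  field_simp
  ring

/-- The ratio of consecutive diagonal entries tends to 16/27; the cruder 3/4 bounds it for every
`k`. -/
theorem accelTerm_diagonal_pos_le (k : ℕ) :
    0 < accelTerm (2 * k) k ∧ accelTerm (2 * k) k ≤ (3 / 4) ^ k := by
  induction k with
  | zero => simp [accelTerm]
  | succ k ih =>
    obtain ⟨h0, h1⟩ := ih
    rw [accelTerm_diagonal]
    refine ⟨by positivity, ?_⟩
    rw [mul_div_assoc, pow_succ]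
    refine mul_le_mul h1 ?_ (by positivity) (by positivity)
    rw [div_le_iff₀ (by positivity)]
    have := Nat.cast_nonneg (α := ℝ) k
    have h : 0 ≤ 3 / 4 * ((2 * (k : ℝ) + 1) * (6 * k + 3) * (6 * k + 5) * (6 * k + 7)) -
        (4 * (k : ℝ) + 1) * (4 * k + 2) * (4 * k + 3) * (4 * k + 4) := by
      ring_nf; positivity
    linarith

/-- The step from row `j` to row `j + 1` costs a factor of at most 1/3 once `n ≥ 2(j+1)`. Near `n =
2j` this factor behaves like `4j²/(2j · 6j) = 1/3`. -/
theorem abs_accelTerm_le (j n : ℕ) (h : 2 * j ≤ n) :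
    |accelTerm j n| ≤ (1 / 3) ^ j / (2 * (n : ℝ) + 1) := by
  induction j with
  | zero =>
    have : 0 < 2 * (n : ℝ) + 1 := by positivity
    simp [accelTerm, abs_div, abs_of_pos this]
  | succ j ih =>
    have ih := ih (by omega)
    have hn : 2 * (j : ℝ) + 2 ≤ n := by exact_mod_cast (by omega : 2 * j + 2 ≤ n)
    have hj := Nat.cast_nonneg (α := ℝ) j
    have hd : 0 < (2 * (n : ℝ) - 2 * j - 1) * (2 * n + 2 * j + 3) := by
      apply mul_pos <;> linarith
    rw [accelTerm_succ_left, abs_neg, mul_div_assoc, abs_mul, pow_succ,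
      mul_div_right_comm ((1 / 3 : ℝ) ^ j)]
    refine mul_le_mul ih ?_ (abs_nonneg _) (by positivity)
    rw [abs_of_nonneg (by positivity), div_le_div_iff₀ hd (by norm_num)]
    nlinarith

theorem IsPerturbation.abs_perturbCert_le {h p s : ℕ → ℕ → ℝ} (hp : IsPerturbation h p s)
    {j n : ℕ} (hj : 2 * (j + 1) ≤ n) :
    |perturbCert h p s j n| ≤ 12 * ((harmonic n : ℝ) + j + 1) * (1 / 3) ^ j / (2 * (n : ℝ) + 1) := by
  have h1 := hp.abs_weight_le j n
  have h2 := hp.abs_shift_le j n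
  have h3 := hp.abs_corr_le j n
  have h4 := abs_accelTerm_le j n (by omega)
  have hH := harmonic_nonneg_real n
  have hj0 := Nat.cast_nonneg (α := ℝ) j
  have hn : 2 * (j : ℝ) + 2 ≤ n := by exact_mod_cast (by omega : 2 * j + 2 ≤ n)
  have h5 : |-(n : ℝ) / (2 * (n : ℝ) - 2 * j - 1)| ≤ 1 := by
    have : 0 < 2 * (n : ℝ) - 2 * j - 1 := by linarith
    rw [abs_div, abs_neg, abs_of_pos this, div_le_one this, abs_of_nonneg (by positivity)]
    linarith
  have h6 : |-(n : ℝ) / (2 * (n : ℝ) - 2 * j - 1) * (h j n + p j n) + s j n| ≤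
      12 * ((harmonic n : ℝ) + j + 1) := by
    calc _ ≤ |-(n : ℝ) / (2 * (n : ℝ) - 2 * j - 1)| * |h j n + p j n| + |s j n| := by
          rw [← abs_mul]; exact abs_add_le _ _
      _ ≤ 1 * (8 * ((harmonic n : ℝ) + j + 1) + 3) + 1 := by
          gcongr
          exact (abs_add_le _ _).trans (add_le_add h1 h2)
      _ ≤ _ := by linarith
  rw [perturbCert, abs_mul]
  calc _ ≤ (1 / 3) ^ j / (2 * (n : ℝ) + 1) * (12 * ((harmonic n : ℝ) + j + 1)) := by gcongr
    _ = _ := by ring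

/-! ### Vanishing of the error terms -/

theorem tendsto_harmonic_div : Filter.Tendsto (fun n : ℕ => (harmonic n : ℝ) / n)
    Filter.atTop (nhds 0) := by
  have h1 : Filter.Tendsto (fun n : ℕ => (1 + Real.log n) / (n : ℝ)) Filter.atTop (nhds 0) := by
    have ha : Filter.Tendsto (fun n : ℕ => (1 : ℝ) / (n : ℝ)) Filter.atTop (nhds 0) :=
      tendsto_one_div_atTop_nhds_zero_nat
    have hb : Filter.Tendsto (fun n : ℕ => Real.log n / (n : ℝ)) Filter.atTop (nhds 0) := by
      have := (Real.isLittleO_log_id_atTop.tendsto_div_nhds_zero).comp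
        (tendsto_natCast_atTop_atTop (R := ℝ))
      exact this
    simpa [add_div] using ha.add hb
  refine squeeze_zero (fun n => div_nonneg (harmonic_nonneg_real n) (by positivity)) (fun n => ?_) h1
  gcongr
  exact harmonic_le_one_add_log n

/-- The boundary terms at column `4K` sum to `O(H_{4K}/K)`, since they decay geometrically in the
row. The leftover part of row `2K` has `3K` entries, each `O(K (3/4)^K)`. -/
theorem IsPerturbation.tendsto_sub {h p s : ℕ → ℕ → ℝ} (hp : IsPerturbation h p s) :
    Filter.Tendsto (fun K : ℕ => ∑ m ∈ Finset.range (4 * K), accelTerm 0 m * h 0 m -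
      ∑ k ∈ Finset.range K, accelSeries h p s k) Filter.atTop (nhds 0) := by
  have hbound : ∀ K : ℕ, |∑ m ∈ Finset.range (4 * K), accelTerm 0 m * h 0 m -
      ∑ k ∈ Finset.range K, accelSeries h p s k| ≤
      48 * (((harmonic (4 * K) : ℝ) + 2) / ((4 * K : ℕ) : ℝ)) +
        32 * (7 * ((K : ℝ) ^ 2 * (3 / 4) ^ K) + (K : ℝ) ^ 1 * (3 / 4) ^ K) := by
    intro K
    -- The cutoff `4K` is the least one for which `abs_perturbCert_le` covers all rows `j ≤ 2K - 1`,
    -- as it needs `2(j+1) ≤ 4K`.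
    rw [sum_eq_sum_diagonal (F := fun j m => accelTerm j m * h j m)
      (G := perturbCert h p s) hp.telescope (4 * K) (by omega : K ≤ 4 * K)]
    have e : ∀ a b c : ℝ, a + b + c - a = b + c := fun a b c => by ring
    have e' : ∀ b c : ℝ, ∑ k ∈ Finset.range K, (accelTerm (2 * k) k * h (2 * k) k -
        perturbCert h p s (2 * k) (k + 1) - perturbCert h p s (2 * k + 1) (k + 1)) + b + c -
        ∑ k ∈ Finset.range K, accelSeries h p s k = b + c := fun b c => e _ b c
    rw [e']
    have hH := harmonic_nonneg_real (4 * K)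
    refine (abs_add_le _ _).trans (add_le_add ?_ ?_)
    · rcases Nat.eq_zero_or_pos K with rfl | hK
      · simp
      have hterm : ∀ k ∈ Finset.range K, |perturbCert h p s (2 * k) (4 * K) +
          perturbCert h p s (2 * k + 1) (4 * K)| ≤
          24 * (((harmonic (4 * K) : ℝ) + 2) / ((4 * K : ℕ) : ℝ)) * (1 / 2) ^ k := by
        intro k hk
        have hk' := Finset.mem_range.mp hk
        have b1 := hp.abs_perturbCert_le (j := 2 * k) (n := 4 * K) (by omega)
        have b2 := hp.abs_perturbCert_le (j := 2 * k + 1) (n := 4 * K) (by omega)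
        -- The decay `9^(-k)` is weakened to `4^(-k)` and still absorbs the linear factor, via `k +
        -- 1 ≤ 2^k`.
        have hpow : ((k : ℝ) + 1) * (1 / 3) ^ (2 * k) ≤ (1 / 2) ^ k := by
          have : (k : ℝ) + 1 ≤ 2 ^ k := by exact_mod_cast Nat.lt_two_pow_self
          calc ((k : ℝ) + 1) * (1 / 3) ^ (2 * k) ≤ 2 ^ k * (1 / 4) ^ k := by
                rw [pow_mul]; gcongr; norm_num
            _ = (1 / 2) ^ k := by rw [← mul_pow]; norm_num
        have hpos : (0 : ℝ) < ((4 * K : ℕ) : ℝ) := by positivity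
        have c0 : ∀ (t : ℕ) (x : ℝ), 0 ≤ x → x ≤ (((harmonic (4 * K) : ℝ)) + 2) * ((k : ℝ) + 1) →
            2 * k ≤ t → 12 * x * (1 / 3) ^ t / (2 * ((4 * K : ℕ) : ℝ) + 1) ≤
            12 * (((harmonic (4 * K) : ℝ) + 2) / ((4 * K : ℕ) : ℝ)) * (1 / 2) ^ k := by
          intro t x hx0 hx ht
          have hpt : ((1 : ℝ) / 3) ^ t ≤ (1 / 3) ^ (2 * k) :=
            pow_le_pow_of_le_one (by norm_num) (by norm_num) ht
          calc 12 * x * (1 / 3) ^ t / (2 * ((4 * K : ℕ) : ℝ) + 1)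
              ≤ 12 * ((((harmonic (4 * K) : ℝ)) + 2) * ((k : ℝ) + 1)) * (1 / 3) ^ (2 * k) /
                ((4 * K : ℕ) : ℝ) := by
                gcongr
                linarith
            _ = 12 * (((harmonic (4 * K) : ℝ) + 2) / ((4 * K : ℕ) : ℝ)) *
                (((k : ℝ) + 1) * (1 / 3) ^ (2 * k)) := by ring
            _ ≤ _ := by gcongr
        have hk0 := Nat.cast_nonneg (α := ℝ) k
        have hHk := mul_nonneg hH hk0
        have c1 := c0 (2 * k) ((harmonic (4 * K) : ℝ) + (2 * k : ℕ) + 1) (by positivity)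
          (by push_cast; nlinarith) le_rfl
        have c2 := c0 (2 * k + 1) ((harmonic (4 * K) : ℝ) + (2 * k + 1 : ℕ) + 1) (by positivity)
          (by push_cast; nlinarith) (by omega)
        have := abs_add_le (perturbCert h p s (2 * k) (4 * K)) (perturbCert h p s (2 * k + 1) (4 * K))
        linarith
      refine (Finset.abs_sum_le_sum_abs _ _).trans ((Finset.sum_le_sum hterm).trans ?_)
      rw [← Finset.mul_sum]
      have hgeo : ∑ k ∈ Finset.range K, ((1 : ℝ) / 2) ^ k ≤ 2 := by
        rw [geom_sum_eq (by norm_num), div_le_iff_of_neg (by norm_num)]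
        have : (0 : ℝ) ≤ (1 / 2) ^ K := by positivity
        linarith
      calc _ ≤ 24 * (((harmonic (4 * K) : ℝ) + 2) / ((4 * K : ℕ) : ℝ)) * 2 := by gcongr
        _ = _ := by ring
    · have hterm : ∀ m ∈ Finset.Ico K (4 * K), |accelTerm (2 * K) m * h (2 * K) m| ≤
          (3 / 4) ^ K * (8 * (7 * K + 1)) := by
        intro m hm
        obtain ⟨hm1, hm2⟩ := Finset.mem_Ico.mp hm
        obtain ⟨hd1, hd2⟩ := accelTerm_diagonal_pos_le K
        rw [abs_mul]
        refine mul_le_mul ?_ ?_ (abs_nonneg _) (by positivity)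
        · refine (abs_accelTerm_le_of_le (2 * K) hm1).trans ?_
          rwa [abs_of_pos hd1]
        · refine (hp.abs_weight_le _ _).trans ?_
          have h1 := harmonic_le_self m
          have h2 : (m : ℝ) ≤ 4 * K := by exact_mod_cast hm2.le
          push_cast
          linarith
      refine (Finset.abs_sum_le_sum_abs _ _).trans ((Finset.sum_le_sum hterm).trans ?_)
      rw [Finset.sum_const, Nat.card_Ico, nsmul_eq_mul]
      have : ((4 * K - K : ℕ) : ℝ) ≤ 4 * K := by
        exact_mod_cast (Nat.sub_le _ _)
      calc _ ≤ (4 * (K : ℝ)) * ((3 / 4) ^ K * (8 * (7 * K + 1))) := by gcongr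
        _ = _ := by ring
  have hlim1 : Filter.Tendsto (fun K : ℕ => ((harmonic (4 * K) : ℝ) + 2) / ((4 * K : ℕ) : ℝ))
      Filter.atTop (nhds 0) := by
    have h4 : Filter.Tendsto (fun K : ℕ => 4 * K) Filter.atTop Filter.atTop :=
      Filter.tendsto_id.const_mul_atTop' (by norm_num)
    have := (tendsto_harmonic_div.add (tendsto_const_div_atTop_nhds_zero_nat 2)).comp h4
    simp only [add_zero] at this
    refine this.congr fun K => ?_
    simp only [Function.comp_apply]
    ring
  have hq : |(3 / 4 : ℝ)| < 1 := by rw [abs_of_pos] <;> norm_num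
  have hlim2 := tendsto_pow_const_mul_const_pow_of_abs_lt_one 2 hq
  have hlim3 := tendsto_pow_const_mul_const_pow_of_abs_lt_one 1 hq
  have hlim := (hlim1.const_mul 48).add (((hlim2.const_mul 7).add hlim3).const_mul 32)
  simp only [mul_zero, add_zero] at hlim
  exact squeeze_zero_norm (fun K => by simpa only [Real.norm_eq_abs] using hbound K) hlim

/-! ### Values of alternating series -/

theorem sum_neg_one_pow_mul_pow (y : ℝ) (N : ℕ) :
    (1 + y) * ∑ n ∈ Finset.range N, (-1) ^ n * y ^ n = 1 - (-1) ^ N * y ^ N := by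
  induction N with
  | zero => simp
  | succ N ih => rw [Finset.sum_range_succ, mul_add, ih]; ring

/-- The remainder has derivative `(-1)^N x^N/(1+x)`, so the mean value inequality bounds it. The
estimate is uniform up to `y = 1`. -/
theorem abs_log_sub_sum_le {y : ℝ} (hy : 0 ≤ y) (N : ℕ) :
    |Real.log (1 + y) - ∑ n ∈ Finset.range N, (-1) ^ n * (y ^ (n + 1) / ((n : ℝ) + 1))| ≤
      y ^ (N + 1) := by
  have hd : ∀ x ∈ Set.Icc 0 y, HasDerivWithinAt (fun x : ℝ => Real.log (1 + x) -
      ∑ n ∈ Finset.range N, (-1) ^ n * (x ^ (n + 1) / ((n : ℝ) + 1)))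
      ((-1) ^ N * x ^ N / (1 + x)) (Set.Icc 0 y) x := by
    intro x hx
    have h1 : 1 + x ≠ 0 := by linarith [hx.1]
    have hlog : HasDerivAt (fun x : ℝ => Real.log (1 + x)) (1 / (1 + x)) x :=
      ((hasDerivAt_id' x).const_add 1).log h1
    have hsum : HasDerivAt (fun x : ℝ => ∑ n ∈ Finset.range N,
        (-1) ^ n * (x ^ (n + 1) / ((n : ℝ) + 1))) (∑ n ∈ Finset.range N, (-1) ^ n * x ^ n) x := by
      refine HasDerivAt.fun_sum fun n _ => ?_
      have := ((hasDerivAt_pow (n + 1) x).div_const ((n : ℝ) + 1)).const_mul ((-1 : ℝ) ^ n)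
      refine this.congr_deriv ?_
      have : (n : ℝ) + 1 ≠ 0 := by positivity
      push_cast
      field_simp
    have := sum_neg_one_pow_mul_pow x N
    refine ((hlog.sub hsum).congr_deriv ?_).hasDerivWithinAt
    field_simp
    linarith
  have hb : ∀ x ∈ Set.Ico 0 y, ‖(-1) ^ N * x ^ N / (1 + x)‖ ≤ y ^ N := by
    intro x hx
    have h1 : 1 ≤ 1 + x := by linarith [hx.1]
    have h0 := hx.1
    rw [norm_div, norm_mul, norm_pow, norm_neg, norm_one, one_pow, one_mul, norm_pow,
      Real.norm_of_nonneg hx.1, Real.norm_of_nonneg (by linarith : (0 : ℝ) ≤ 1 + x)]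
    exact (div_le_self (by positivity) h1).trans (pow_le_pow_left₀ hx.1 hx.2.le N)
  have := norm_image_sub_le_of_norm_deriv_le_segment' hd hb y ⟨hy, le_rfl⟩
  simpa [Real.norm_eq_abs, pow_succ] using this

theorem abs_arctan_sub_sum_le {y : ℝ} (hy : 0 ≤ y) (N : ℕ) :
    |Real.arctan y - ∑ n ∈ Finset.range N, (-1) ^ n * (y ^ (2 * n + 1) / (2 * (n : ℝ) + 1))| ≤
      y ^ (2 * N + 1) := by
  have hd : ∀ x ∈ Set.Icc 0 y, HasDerivWithinAt (fun x : ℝ => Real.arctan x -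
      ∑ n ∈ Finset.range N, (-1) ^ n * (x ^ (2 * n + 1) / (2 * (n : ℝ) + 1)))
      ((-1) ^ N * x ^ (2 * N) / (1 + x ^ 2)) (Set.Icc 0 y) x := by
    intro x hx
    have h1 : 1 + x ^ 2 ≠ 0 := by positivity
    have hsum : HasDerivAt (fun x : ℝ => ∑ n ∈ Finset.range N,
        (-1) ^ n * (x ^ (2 * n + 1) / (2 * (n : ℝ) + 1)))
        (∑ n ∈ Finset.range N, (-1) ^ n * (x ^ 2) ^ n) x := by
      refine HasDerivAt.fun_sum fun n _ => ?_
      have := ((hasDerivAt_pow (2 * n + 1) x).div_const (2 * (n : ℝ) + 1)).const_mul ((-1 : ℝ) ^ n)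
      refine this.congr_deriv ?_
      have : 2 * (n : ℝ) + 1 ≠ 0 := by positivity
      push_cast
      field_simp
      simp [pow_mul]
    have := sum_neg_one_pow_mul_pow (x ^ 2) N
    refine (((Real.hasDerivAt_arctan x).sub hsum).congr_deriv ?_).hasDerivWithinAt
    field_simp
    rw [pow_mul]
    linarith
  have hb : ∀ x ∈ Set.Ico 0 y, ‖(-1) ^ N * x ^ (2 * N) / (1 + x ^ 2)‖ ≤ y ^ (2 * N) := by
    intro x hx
    have h0 := hx.1
    have h1 : 1 ≤ 1 + x ^ 2 := by nlinarith
    rw [norm_div, norm_mul, norm_pow, norm_neg, norm_one, one_pow, one_mul, norm_pow,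
      Real.norm_of_nonneg hx.1, Real.norm_of_nonneg (by linarith : (0 : ℝ) ≤ 1 + x ^ 2)]
    exact (div_le_self (by positivity) h1).trans (pow_le_pow_left₀ hx.1 hx.2.le _)
  have := norm_image_sub_le_of_norm_deriv_le_segment' hd hb y ⟨hy, le_rfl⟩
  simpa [Real.norm_eq_abs, pow_succ] using this

/-! ### Alternating harmonic sums as integrals -/

theorem abs_integral_le_of_abs_le_pow {φ : ℝ → ℝ} {c : ℝ} (n : ℕ)
    (h : ∀ x ∈ Set.Ioc (0 : ℝ) 1, |φ x| ≤ c * x ^ n) :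
    |∫ x in (0 : ℝ)..1, φ x| ≤ c / ((n : ℝ) + 1) := by
  have := intervalIntegral.norm_integral_le_of_norm_le (f := φ) (g := fun x => c * x ^ n)
    (μ := MeasureTheory.volume) zero_le_one
    (Filter.Eventually.of_forall fun x hx => by simpa [Real.norm_eq_abs] using h x hx)
    (Continuous.intervalIntegrable (by fun_prop) _ _)
  rw [intervalIntegral.integral_const_mul, integral_pow] at this
  simpa [Real.norm_eq_abs, div_eq_mul_inv] using this

theorem integral_sum_pow (a : ℕ → ℝ) (N : ℕ) :
    ∫ x in (0 : ℝ)..1, ∑ n ∈ Finset.range N, a n * x ^ (2 * n) =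
      ∑ n ∈ Finset.range N, a n / (2 * (n : ℝ) + 1) := by
  rw [intervalIntegral.integral_finsetSum
    fun i _ => Continuous.intervalIntegrable (by fun_prop) _ _]
  refine Finset.sum_congr rfl fun n _ => ?_
  rw [intervalIntegral.integral_const_mul, integral_pow]
  push_cast
  simp [div_eq_mul_inv]

theorem continuous_log_one_add_sq : Continuous fun x : ℝ => Real.log (1 + x ^ 2) :=
  Continuous.log (by fun_prop) fun x => by positivity

theorem continuous_log_div : Continuous fun x : ℝ => Real.log (1 + x ^ 2) / (1 + x ^ 2) :=
  continuous_log_one_add_sq.div (by fun_prop) fun x => by positivity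

/-- Truncated form of `∑ (-1)^n H_n y^n = -log(1+y)/(1+y)`, with an explicit remainder. -/
theorem sum_harmonic_mul_pow (y : ℝ) (N : ℕ) :
    (1 + y) * ∑ n ∈ Finset.range (N + 1), (-1) ^ n * (harmonic n : ℝ) * y ^ n =
      -(∑ n ∈ Finset.range N, (-1) ^ n * (y ^ (n + 1) / ((n : ℝ) + 1))) +
        (-1) ^ N * (harmonic N : ℝ) * y ^ (N + 1) := by
  induction N with
  | zero => simp
  | succ N ih =>
    rw [Finset.sum_range_succ, mul_add, ih, Finset.sum_range_succ _ N, harmonic_succ_real]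
    ring

theorem tendsto_one_add_harmonic_div :
    Filter.Tendsto (fun N : ℕ => (1 + (harmonic N : ℝ)) / (2 * (N : ℝ) + 1)) Filter.atTop
      (nhds 0) := by
  have h := (tendsto_const_div_atTop_nhds_zero_nat (1 : ℝ)).add tendsto_harmonic_div
  rw [add_zero] at h
  refine squeeze_zero' (Filter.Eventually.of_forall fun N => ?_) ?_ h
  · have := harmonic_nonneg_real N
    positivity
  · filter_upwards [Filter.eventually_gt_atTop 0] with N hN
    have := harmonic_nonneg_real N
    have hN' : (0 : ℝ) < N := by exact_mod_cast hN
    rw [← add_div]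
    gcongr
    linarith

/-- The pointwise error of the truncated generating function is at most `(1 + H_N) x^(2N)`.
Integration gains `1/(2N+1)`, which beats the logarithmic growth of `H_N`. -/
theorem tendsto_sum_harmonic : Filter.Tendsto
    (fun N : ℕ => ∑ n ∈ Finset.range N, (-1) ^ n * (harmonic n : ℝ) / (2 * (n : ℝ) + 1))
    Filter.atTop (nhds (-∫ x in (0 : ℝ)..1, Real.log (1 + x ^ 2) / (1 + x ^ 2))) := by
  rw [← Filter.tendsto_add_atTop_iff_nat 1, tendsto_iff_norm_sub_tendsto_zero]
  refine squeeze_zero (fun _ => norm_nonneg _) (fun N => ?_) tendsto_one_add_harmonic_div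
  rw [sub_neg_eq_add, Real.norm_eq_abs, ← integral_sum_pow,
    ← intervalIntegral.integral_add (Continuous.intervalIntegrable (by fun_prop) _ _)
      (continuous_log_div.intervalIntegrable _ _)]
  have := abs_integral_le_of_abs_le_pow (c := 1 + (harmonic N : ℝ)) (2 * N)
    (φ := fun x => ∑ n ∈ Finset.range (N + 1), (-1) ^ n * (harmonic n : ℝ) * x ^ (2 * n) +
      Real.log (1 + x ^ 2) / (1 + x ^ 2)) ?_
  · simpa using this
  intro x hx
  have h1 : 0 < 1 + x ^ 2 := by positivity
  have hs := sum_harmonic_mul_pow (x ^ 2) N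
  have hl := abs_log_sub_sum_le (sq_nonneg x) N
  have hH := harmonic_nonneg_real N
  simp only [← pow_mul] at hs hl
  set S := ∑ n ∈ Finset.range (N + 1), (-1) ^ n * (harmonic n : ℝ) * x ^ (2 * n)
  set l := ∑ n ∈ Finset.range N, (-1) ^ n * (x ^ (2 * (n + 1)) / ((n : ℝ) + 1))
  have e : S + Real.log (1 + x ^ 2) / (1 + x ^ 2) =
      ((Real.log (1 + x ^ 2) - l) + (-1) ^ N * (harmonic N : ℝ) * x ^ (2 * (N + 1))) /
        (1 + x ^ 2) := by
    field_simp
    linarith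
  have hx2 : x ^ (2 * (N + 1)) ≤ x ^ (2 * N) :=
    pow_le_pow_of_le_one hx.1.le hx.2 (by omega)
  rw [e, abs_div, abs_of_pos h1]
  refine (div_le_self (abs_nonneg _) (by nlinarith [sq_nonneg x])).trans ?_
  calc _ ≤ |Real.log (1 + x ^ 2) - l| + |(-1) ^ N * (harmonic N : ℝ) * x ^ (2 * (N + 1))| :=
        abs_add_le _ _
    _ ≤ x ^ (2 * (N + 1)) + (harmonic N : ℝ) * x ^ (2 * (N + 1)) := by
        gcongr
        rw [abs_mul, abs_mul, abs_pow, abs_neg, abs_one, one_pow, one_mul, abs_of_nonneg hH,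
          abs_of_nonneg (pow_nonneg hx.1.le _)]
    _ = (1 + (harmonic N : ℝ)) * x ^ (2 * (N + 1)) := by ring
    _ ≤ _ := by gcongr

theorem sum_oddHarmonic_mul_pow (y : ℝ) (N : ℕ) :
    (1 + y) * ∑ n ∈ Finset.range N, (-1) ^ n * oddHarmonic (n + 1) * y ^ n =
      ∑ n ∈ Finset.range N, (-1) ^ n * (y ^ n / (2 * (n : ℝ) + 1)) -
        (-1) ^ N * oddHarmonic N * y ^ N := by
  induction N with
  | zero => simp [oddHarmonic]
  | succ N ih =>
    rw [Finset.sum_range_succ, mul_add, ih, Finset.sum_range_succ _ N, oddHarmonic_succ]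
    ring

theorem summable_catalan : Summable fun k : ℕ => (-1 : ℝ) ^ k / (2 * (k : ℝ) + 1) ^ 2 := by
  have h : Summable fun k : ℕ => 1 / ((k : ℝ) + 1) ^ 2 := by
    have := (summable_nat_add_iff 1).mpr (Real.summable_one_div_nat_pow.mpr one_lt_two)
    simpa using this
  refine Summable.of_norm_bounded h fun k => ?_
  rw [norm_div, norm_pow, norm_neg, norm_one, one_pow, Real.norm_of_nonneg (by positivity)]
  have := Nat.cast_nonneg (α := ℝ) k
  gcongr
  linarith

theorem tendsto_sum_catalan : Filter.Tendsto
    (fun N : ℕ => ∑ n ∈ Finset.range N, (-1 : ℝ) ^ n / (2 * (n : ℝ) + 1) ^ 2)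
    Filter.atTop (nhds catalanConstant) :=
  summable_catalan.hasSum.tendsto_sum_nat

theorem continuous_mul_arctan_div : Continuous fun x : ℝ => x * Real.arctan x / (1 + x ^ 2) :=
  Continuous.div (by fun_prop) (by fun_prop) fun x => by positivity

/-- The generating function is `arctan x/(x(1+x²)) = arctan x/x - x arctan x/(1+x²)`. The first part
integrates to Catalan's constant; its series is subtracted termwise, so that no quotient by `x`
appears. -/
theorem tendsto_sum_oddHarmonic : Filter.Tendsto
    (fun N : ℕ => ∑ n ∈ Finset.range N, (-1) ^ n * oddHarmonic (n + 1) / (2 * (n : ℝ) + 1))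
    Filter.atTop
    (nhds (catalanConstant - ∫ x in (0 : ℝ)..1, x * Real.arctan x / (1 + x ^ 2))) := by
  have key : Filter.Tendsto (fun N : ℕ =>
      (∑ n ∈ Finset.range N, (-1) ^ n * oddHarmonic (n + 1) / (2 * (n : ℝ) + 1) -
      ∑ n ∈ Finset.range N, (-1 : ℝ) ^ n / (2 * (n : ℝ) + 1) ^ 2) -
      -∫ x in (0 : ℝ)..1, x * Real.arctan x / (1 + x ^ 2)) Filter.atTop (nhds 0) := by
    refine squeeze_zero_norm (fun N => ?_) tendsto_one_add_harmonic_div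
    have e0 : ∀ n ∈ Finset.range N, (-1 : ℝ) ^ n / (2 * (n : ℝ) + 1) ^ 2 =
        ((-1) ^ n / (2 * (n : ℝ) + 1)) / (2 * (n : ℝ) + 1) := fun n _ => by
      rw [div_div, sq]
    rw [Finset.sum_congr rfl e0, sub_neg_eq_add, Real.norm_eq_abs, ← integral_sum_pow,
      ← integral_sum_pow,
      ← intervalIntegral.integral_sub (Continuous.intervalIntegrable (by fun_prop) _ _)
        (Continuous.intervalIntegrable (by fun_prop) _ _),
      ← intervalIntegral.integral_add (Continuous.intervalIntegrable (by fun_prop) _ _)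
        (continuous_mul_arctan_div.intervalIntegrable _ _)]
    have := abs_integral_le_of_abs_le_pow (c := 1 + (harmonic N : ℝ)) (2 * N)
      (φ := fun x => ∑ n ∈ Finset.range N, (-1) ^ n * oddHarmonic (n + 1) * x ^ (2 * n) -
        ∑ n ∈ Finset.range N, (-1) ^ n / (2 * (n : ℝ) + 1) * x ^ (2 * n) +
        x * Real.arctan x / (1 + x ^ 2)) ?_
    · simpa using this
    intro x hx
    have h1 : 0 < 1 + x ^ 2 := by positivity
    have hs := sum_oddHarmonic_mul_pow (x ^ 2) N
    have hl := abs_arctan_sub_sum_le hx.1.le N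
    have hO := oddHarmonic_nonneg N
    have hOH := oddHarmonic_le_harmonic N
    have hq : ∑ n ∈ Finset.range N, (-1) ^ n * (x ^ (2 * n + 1) / (2 * (n : ℝ) + 1)) =
        x * ∑ n ∈ Finset.range N, (-1) ^ n / (2 * (n : ℝ) + 1) * x ^ (2 * n) := by
      rw [Finset.mul_sum]
      exact Finset.sum_congr rfl fun n _ => by ring
    have hq' : ∑ n ∈ Finset.range N, (-1) ^ n * ((x ^ 2) ^ n / (2 * (n : ℝ) + 1)) =
        ∑ n ∈ Finset.range N, (-1) ^ n / (2 * (n : ℝ) + 1) * x ^ (2 * n) :=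
      Finset.sum_congr rfl fun n _ => by rw [← pow_mul]; ring
    rw [hq'] at hs
    rw [hq] at hl
    simp only [← pow_mul] at hs
    set S := ∑ n ∈ Finset.range N, (-1) ^ n * oddHarmonic (n + 1) * x ^ (2 * n)
    set q := ∑ n ∈ Finset.range N, (-1) ^ n / (2 * (n : ℝ) + 1) * x ^ (2 * n)
    have e : S - q + x * Real.arctan x / (1 + x ^ 2) =
        (x * (Real.arctan x - x * q) - (-1) ^ N * oddHarmonic N * x ^ (2 * N)) /
          (1 + x ^ 2) := by
      field_simp
      linarith
    have hx2 : x * x ^ (2 * N + 1) ≤ x ^ (2 * N) := by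
      rw [← pow_succ']
      exact pow_le_pow_of_le_one hx.1.le hx.2 (by omega)
    rw [e, abs_div, abs_of_pos h1]
    refine (div_le_self (abs_nonneg _) (by nlinarith [sq_nonneg x])).trans ?_
    calc _ ≤ |x * (Real.arctan x - x * q)| + |(-1) ^ N * oddHarmonic N * x ^ (2 * N)| :=
          abs_sub _ _
      _ ≤ x * x ^ (2 * N + 1) + oddHarmonic N * x ^ (2 * N) := by
          rw [abs_mul, abs_mul, abs_mul, abs_pow, abs_neg, abs_one, one_pow, one_mul,
            abs_of_nonneg hO, abs_of_nonneg (pow_nonneg hx.1.le _), abs_of_nonneg hx.1.le]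
          gcongr
          exact hx.1.le
      _ ≤ x ^ (2 * N) + (harmonic N : ℝ) * x ^ (2 * N) := by
          have := pow_nonneg hx.1.le (2 * N)
          gcongr
      _ = _ := by ring
  have := (key.add tendsto_sum_catalan).add_const
    (-∫ x in (0 : ℝ)..1, x * Real.arctan x / (1 + x ^ 2))
  rw [zero_add, ← sub_eq_add_neg] at this
  exact this.congr fun N => by ring

/-! ### Closed forms of the integrals -/

theorem integral_mul_arctan_div : ∫ x in (0 : ℝ)..1, x * Real.arctan x / (1 + x ^ 2) =
    Real.pi / 8 * Real.log 2 - 1 / 2 * ∫ x in (0 : ℝ)..1, Real.log (1 + x ^ 2) / (1 + x ^ 2) := by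
  have hv : ∀ x : ℝ, HasDerivAt (fun x : ℝ => 1 / 2 * Real.log (1 + x ^ 2)) (x / (1 + x ^ 2)) x := by
    intro x
    have h1 : 1 + x ^ 2 ≠ 0 := by positivity
    have := (((hasDerivAt_pow 2 x).const_add 1).log h1).const_mul (1 / 2 : ℝ)
    refine this.congr_deriv ?_
    field_simp
    simp
  have hc1 : Continuous fun x : ℝ => 1 / (1 + x ^ 2) :=
    continuous_const.div (by fun_prop) fun x => by positivity
  have hc2 : Continuous fun x : ℝ => x / (1 + x ^ 2) :=
    continuous_id.div (by fun_prop) fun x => by positivity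
  have := intervalIntegral.integral_mul_deriv_eq_deriv_mul (a := 0) (b := 1)
    (fun x _ => Real.hasDerivAt_arctan x) (fun x _ => hv x)
    (hc1.intervalIntegrable _ _) (hc2.intervalIntegrable _ _)
  have e1 : ∀ x : ℝ, x * Real.arctan x / (1 + x ^ 2) = Real.arctan x * (x / (1 + x ^ 2)) :=
    fun x => by ring
  have e2 : ∀ x : ℝ, 1 / (1 + x ^ 2) * (1 / 2 * Real.log (1 + x ^ 2)) =
    1 / 2 * (Real.log (1 + x ^ 2) / (1 + x ^ 2)) := fun x => by ring
  simp only [e1, this, e2, intervalIntegral.integral_const_mul, Real.arctan_one, Real.arctan_zero]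
  norm_num
  ring

theorem integral_pow_mul_log (n : ℕ) :
    ∫ x in (0 : ℝ)..1, x ^ n * Real.log x = -(1 / ((n : ℝ) + 1) ^ 2) := by
  have hn : (n : ℝ) + 1 ≠ 0 := by positivity
  -- The antiderivative is written with `x * log x` to make its continuity at 0 visible.
  have hcont : Continuous fun x : ℝ => x ^ n * (x * Real.log x) / ((n : ℝ) + 1) -
      x ^ (n + 1) / ((n : ℝ) + 1) ^ 2 := by
    have := Real.continuous_mul_log
    fun_prop
  rw [intervalIntegral.integral_eq_sub_of_hasDerivAt_of_le zero_le_one hcont.continuousOn]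
  · simp
  · intro x hx
    have hx0 : x ≠ 0 := hx.1.ne'
    have h1 := ((hasDerivAt_pow (n + 1) x).mul (Real.hasDerivAt_log hx0)).div_const ((n : ℝ) + 1)
    have h2 := (hasDerivAt_pow (n + 1) x).div_const (((n : ℝ) + 1) ^ 2)
    have h3 := h1.sub h2
    have e : (fun x : ℝ => x ^ n * (x * Real.log x) / ((n : ℝ) + 1) -
      x ^ (n + 1) / ((n : ℝ) + 1) ^ 2) = fun x : ℝ => (x ^ (n + 1) * Real.log x) / ((n : ℝ) + 1) -
      x ^ (n + 1) / ((n : ℝ) + 1) ^ 2 := by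
      funext x; ring
    rw [e]
    refine h3.congr_deriv ?_
    push_cast
    simp only [pow_succ]
    field_simp
    ring
  · exact intervalIntegral.intervalIntegrable_log'.continuousOn_mul (by fun_prop)

/-- A finite geometric expansion of `1/(1+x²)` with exact remainder yields the partial sums of
Catalan's series; the remainder integral is at most `1/(2N+1)²`. -/
theorem integral_log_div : ∫ x in (0 : ℝ)..1, Real.log x / (1 + x ^ 2) = -catalanConstant := by
  have hc : ∀ n : ℕ, Continuous fun x : ℝ => x ^ n / (1 + x ^ 2) := fun n =>
    (continuous_pow n).div (by fun_prop) fun x => by positivity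
  have hint : ∀ n : ℕ, IntervalIntegrable (fun x : ℝ => x ^ n / (1 + x ^ 2) * Real.log x)
      MeasureTheory.volume 0 1 := fun n =>
    intervalIntegral.intervalIntegrable_log'.continuousOn_mul (hc n).continuousOn
  have hpow : ∀ n : ℕ, IntervalIntegrable (fun x : ℝ => x ^ n * Real.log x)
      MeasureTheory.volume 0 1 := fun n =>
    intervalIntegral.intervalIntegrable_log'.continuousOn_mul (by fun_prop)
  have hstep : ∀ N : ℕ, ∫ x in (0 : ℝ)..1, Real.log x / (1 + x ^ 2) =
      -(∑ n ∈ Finset.range N, (-1 : ℝ) ^ n / (2 * (n : ℝ) + 1) ^ 2) +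
        (-1) ^ N * ∫ x in (0 : ℝ)..1, x ^ (2 * N) / (1 + x ^ 2) * Real.log x := by
    intro N
    induction N with
    | zero => simp [div_eq_mul_inv, mul_comm]
    | succ N ih =>
      have e : ∀ x : ℝ, x ^ (2 * N) / (1 + x ^ 2) * Real.log x =
          x ^ (2 * N) * Real.log x - x ^ (2 * (N + 1)) / (1 + x ^ 2) * Real.log x := by
        intro x
        have h1 : 1 + x ^ 2 ≠ 0 := by positivity
        field_simp
        ring
      have e' : ∫ x in (0 : ℝ)..1, x ^ (2 * N) / (1 + x ^ 2) * Real.log x =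
          ∫ x in (0 : ℝ)..1,
            (x ^ (2 * N) * Real.log x - x ^ (2 * (N + 1)) / (1 + x ^ 2) * Real.log x) :=
        intervalIntegral.integral_congr fun x _ => e x
      rw [ih, e', intervalIntegral.integral_sub (hpow _) (hint _), integral_pow_mul_log,
        Finset.sum_range_succ, pow_succ]
      push_cast
      ring
  have hrem : Filter.Tendsto (fun N : ℕ => (-1 : ℝ) ^ N *
      ∫ x in (0 : ℝ)..1, x ^ (2 * N) / (1 + x ^ 2) * Real.log x) Filter.atTop (nhds 0) := by
    refine squeeze_zero_norm (fun N => ?_) tendsto_one_add_harmonic_div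
    rw [norm_mul, norm_pow, norm_neg, norm_one, one_pow, one_mul]
    have hb : ‖∫ x in (0 : ℝ)..1, x ^ (2 * N) / (1 + x ^ 2) * Real.log x‖ ≤
        ∫ x in (0 : ℝ)..1, -(x ^ (2 * N) * Real.log x) := by
      refine intervalIntegral.norm_integral_le_of_norm_le zero_le_one
        (Filter.Eventually.of_forall fun x hx => ?_) (hpow _).neg
      have hlog : Real.log x ≤ 0 := Real.log_nonpos hx.1.le hx.2
      have hx0 := hx.1
      rw [norm_mul, Real.norm_of_nonpos hlog, Real.norm_of_nonneg (by positivity), ← mul_neg]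
      refine mul_le_mul_of_nonneg_right (div_le_self (by positivity) (by nlinarith)) (by linarith)
    rw [intervalIntegral.integral_neg, integral_pow_mul_log, neg_neg] at hb
    push_cast at hb
    refine hb.trans ?_
    have hH := harmonic_nonneg_real N
    have hN := Nat.cast_nonneg (α := ℝ) N
    rw [div_le_div_iff₀ (by positivity) (by positivity)]
    nlinarith [mul_nonneg hH (sq_nonneg (2 * (N : ℝ) + 1))]
  have h := tendsto_sum_catalan.neg.add hrem
  rw [add_zero] at h
  exact tendsto_nhds_unique (tendsto_const_nhds.congr hstep) h

/-- Under `x = tan t` the integral becomes `-2 ∫ log cos` over `[0, π/4]`. There the difference of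
`∫ log sin` and `∫ log cos` is `∫ log tan = -G`, and by reflection their sum is the integral of `log
sin` over `[0, π/2]`. -/
theorem integral_log_one_add_sq_div : ∫ x in (0 : ℝ)..1, Real.log (1 + x ^ 2) / (1 + x ^ 2) =
    Real.pi / 2 * Real.log 2 - catalanConstant := by
  have hpi := Real.pi_pos
  have hsinI : ∀ a b : ℝ, IntervalIntegrable (fun x => Real.log (Real.sin x))
      MeasureTheory.volume a b := fun a b => intervalIntegrable_log_sin
  have hcosI : ∀ a b : ℝ, IntervalIntegrable (fun x => Real.log (Real.cos x))
      MeasureTheory.volume a b := fun a b => intervalIntegrable_log_cos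
  have hc1 : Continuous fun x : ℝ => 1 / (1 + x ^ 2) :=
    continuous_const.div (by fun_prop) fun x => by positivity
  have himg : Real.arctan '' Set.uIcc 0 1 ⊆ Set.Icc 0 (Real.pi / 4) := by
    rintro _ ⟨x, hx, rfl⟩
    rw [Set.uIcc_of_le zero_le_one] at hx
    exact ⟨Real.arctan_zero ▸ Real.arctan_mono hx.1, Real.arctan_one ▸ Real.arctan_mono hx.2⟩
  have himg' : Real.arctan '' Set.Ioo (min 0 1) (max 0 1) ⊆ Set.Ioo 0 (Real.pi / 4) := by
    rintro _ ⟨x, hx, rfl⟩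
    rw [min_eq_left zero_le_one, max_eq_right zero_le_one] at hx
    exact ⟨Real.arctan_zero ▸ Real.arctan_strictMono hx.1,
      Real.arctan_one ▸ Real.arctan_strictMono hx.2⟩
  have hcos : ∫ x in (0 : ℝ)..1, Real.log (1 + x ^ 2) / (1 + x ^ 2) =
      -2 * ∫ t in (0 : ℝ)..(Real.pi / 4), Real.log (Real.cos t) := by
    have := intervalIntegral.integral_comp_mul_deriv' (a := 0) (b := 1)
      (g := fun t => Real.log (Real.cos t)) (fun x _ => Real.hasDerivAt_arctan x)
      hc1.continuousOn ?_
    · rw [Real.arctan_zero, Real.arctan_one] at this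
      rw [← this, ← intervalIntegral.integral_const_mul]
      refine intervalIntegral.integral_congr fun x _ => ?_
      have h1 : 0 < 1 + x ^ 2 := by positivity
      simp only [Function.comp_apply, Real.cos_arctan]
      rw [one_div (√_), Real.log_inv, Real.log_sqrt h1.le]
      ring
    · refine ContinuousOn.mono ?_ himg
      refine ContinuousOn.log Real.continuous_cos.continuousOn fun t ht => ?_
      exact (Real.cos_pos_of_mem_Ioo ⟨by linarith [ht.1], by linarith [ht.2]⟩).ne'
  have htan : ∫ t in (0 : ℝ)..(Real.pi / 4), (Real.log (Real.sin t) - Real.log (Real.cos t)) =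
      -catalanConstant := by
    -- As `log sin` is singular at 0, this substitution asks for continuity only in the open
    -- interval, together with integrability.
    have := intervalIntegral.integral_comp_mul_deriv''' (a := 0) (b := 1)
      (g := fun t => Real.log (Real.sin t) - Real.log (Real.cos t)) (f := Real.arctan)
      (f' := fun x => 1 / (1 + x ^ 2))
      Real.continuous_arctan.continuousOn
      (fun x _ => (Real.hasDerivAt_arctan x).hasDerivWithinAt) ?_ ?_ ?_
    · rw [Real.arctan_zero, Real.arctan_one] at this
      rw [← this, ← integral_log_div]
      refine intervalIntegral.integral_congr_ae (Filter.Eventually.of_forall fun x hx => ?_)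
      rw [Set.uIoc_of_le zero_le_one] at hx
      have h1 : 0 < √(1 + x ^ 2) := by positivity
      simp only [Function.comp_apply, Real.cos_arctan, Real.sin_arctan]
      rw [← Real.log_div (div_pos hx.1 h1).ne' (by positivity)]
      rw [div_div_div_cancel_right₀ h1.ne', div_one]
      ring
    · refine ContinuousOn.mono ?_ himg'
      refine ContinuousOn.sub (ContinuousOn.log Real.continuous_sin.continuousOn fun t ht => ?_)
        (ContinuousOn.log Real.continuous_cos.continuousOn fun t ht => ?_)
      · exact (Real.sin_pos_of_mem_Ioo ⟨ht.1, by linarith [ht.2]⟩).ne'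
      · exact (Real.cos_pos_of_mem_Ioo ⟨by linarith [ht.1], by linarith [ht.2]⟩).ne'
    · refine MeasureTheory.IntegrableOn.mono_set ?_ himg
      have := (hsinI 0 (Real.pi / 4)).sub (hcosI 0 (Real.pi / 4))
      rwa [intervalIntegrable_iff_integrableOn_Icc_of_le (by positivity)] at this
    · have hlog : IntervalIntegrable (fun x : ℝ => 1 / (1 + x ^ 2) * Real.log x)
          MeasureTheory.volume 0 1 :=
        intervalIntegral.intervalIntegrable_log'.continuousOn_mul hc1.continuousOn
      rw [intervalIntegrable_iff_integrableOn_Ioc_of_le zero_le_one] at hlog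
      rw [Set.uIcc_of_le zero_le_one, integrableOn_Icc_iff_integrableOn_Ioc]
      refine hlog.congr_fun (fun x hx => ?_) measurableSet_Ioc
      have h1 : 0 < √(1 + x ^ 2) := by positivity
      simp only [Function.comp_apply, Real.cos_arctan, Real.sin_arctan]
      rw [← Real.log_div (div_pos hx.1 h1).ne' (by positivity)]
      rw [div_div_div_cancel_right₀ h1.ne', div_one]
      ring
  rw [intervalIntegral.integral_sub (hsinI _ _) (hcosI _ _)] at htan
  have hsplit := intervalIntegral.integral_add_adjacent_intervals
    (hsinI 0 (Real.pi / 4)) (hsinI (Real.pi / 4) (Real.pi / 2))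
  rw [integral_log_sin_zero_pi_div_two] at hsplit
  have hrefl : ∫ t in (Real.pi / 4)..(Real.pi / 2), Real.log (Real.sin t) =
      ∫ t in (0 : ℝ)..(Real.pi / 4), Real.log (Real.cos t) := by
    have := intervalIntegral.integral_comp_sub_left (a := 0) (b := Real.pi / 4)
      (fun t => Real.log (Real.sin t)) (Real.pi / 2)
    simp only [Real.sin_pi_div_two_sub, sub_zero] at this
    rw [this]
    congr 1
    ring
  rw [hrefl] at hsplit
  rw [hcos]
  linarith

/-! ### The three accelerated series -/

theorem harmonic_two_mul (n : ℕ) :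
    (harmonic (2 * n) : ℝ) = oddHarmonic n + (harmonic n : ℝ) / 2 := by
  induction n with
  | zero => simp [oddHarmonic]
  | succ n ih =>
    rw [show 2 * (n + 1) = 2 * n + 1 + 1 by ring, harmonic_succ_real, harmonic_succ_real, ih,
      oddHarmonic_succ, harmonic_succ_real]
    have h1 : (n : ℝ) + 1 ≠ 0 := by positivity
    have h2 : 2 * (n : ℝ) + 1 ≠ 0 := by positivity
    push_cast
    have h3 : 2 * (n : ℝ) + 1 + 1 ≠ 0 := by positivity
    field_simp
    ring

theorem two_mul_sub_one_ne_zero (k : ℕ) : 2 * (k : ℝ) - 1 ≠ 0 := by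
  simpa using odd_ne_zero k 0

/-- The window is `-k ≤ i ≤ k`. The reflection `i ↦ -1-i` changes the sign of `2i+1`, so everything
cancels except `i = k`. -/
theorem oddWindow_diagonal (k : ℕ) : oddWindow (2 * k) k = 2 / (2 * (k : ℝ) + 1) := by
  induction k with
  | zero => simp [oddWindow]
  | succ k ih =>
    rw [show 2 * (k + 1) = 2 * k + 1 + 1 by ring, oddWindow_succ_left, oddWindow_succ_left,
      oddWindow_succ_right, ih]
    push_cast
    rw [show 2 * (k : ℝ) + 1 - 2 * (2 * k) = -(2 * k - 1) by ring,
      show 2 * ((k : ℝ) + 1) - 2 * (2 * k) - 1 = -(2 * k - 1) by ring,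
      show 2 * ((k : ℝ) + 1) - 2 * (2 * k + 1) - 1 = -(2 * k + 1) by ring,
      show 2 * ((k : ℝ) + 1) + 1 = 2 * k + 3 by ring, div_neg, div_neg]
    ring

/-- The factor `2k - 1` of `accelTerm (2k) (k+1)` cancels the denominator of the certificate there.
-/
theorem accelSeries_eq (h p s : ℕ → ℕ → ℝ) (k : ℕ) : accelSeries h p s k =
    accelTerm (2 * k) k * (h (2 * k) k
      - ((k : ℝ) + 1) / (6 * k + 3) * (h (2 * k) (k + 1) + p (2 * k) (k + 1))
      - 2 * (4 * (k : ℝ) + 1) * (k + 1) / ((6 * k + 3) * (6 * k + 5)) *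
        (h (2 * k + 1) (k + 1) + p (2 * k + 1) (k + 1))
      - (2 * (k : ℝ) - 1) / (6 * k + 3) * s (2 * k) (k + 1)
      - 2 * (4 * (k : ℝ) + 1) / (3 * (6 * k + 5)) * s (2 * k + 1) (k + 1)) := by
  rw [accelSeries, perturbCert, perturbCert, accelTerm_diagonal_right, accelTerm_diagonal_succ]
  have h1 := two_mul_sub_one_ne_zero k
  have h2 : 2 * (k : ℝ) + 1 ≠ 0 := by positivity
  have h3 : 6 * (k : ℝ) + 5 ≠ 0 := by positivity
  push_cast
  rw [show 2 * ((k : ℝ) + 1) - 2 * (2 * k) - 1 = -(2 * k - 1) by ring,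
    show 2 * ((k : ℝ) + 1) - 2 * (2 * k + 1) - 1 = -(2 * k + 1) by ring,
    show 6 * (k : ℝ) + 3 = 3 * (2 * k + 1) by ring, neg_div_neg_eq, neg_div_neg_eq]
  field_simp
  ring

theorem accelSeries_odd (k : ℕ) :
    accelSeries (fun j m => 4 * oddHarmonic m + 2 * (1 / (2 * (m : ℝ) + 1)) - harmonic j)
      (fun _ m => -2 * (1 / (2 * (m : ℝ) + 1))) (fun _ _ => 0) k =
    accelTerm (2 * k) k / ((6 * k + 3) * (6 * k + 5)) *
      ((2 * (k : ℝ) + 1) * (11 * k + 8) * (4 * oddHarmonic k - harmonic (2 * k)) +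
        2 * (3 * (k : ℝ) + 2) * (4 * k + 1) / (2 * k + 1)) := by
  rw [accelSeries_eq]
  simp only [oddHarmonic_succ, harmonic_succ_real]
  have h2 : 2 * (k : ℝ) + 1 ≠ 0 := by positivity
  have h3 : 6 * (k : ℝ) + 5 ≠ 0 := by positivity
  have h4 : 2 * ((k : ℝ) + 1) + 1 ≠ 0 := by positivity
  generalize accelTerm (2 * k) k = D
  generalize oddHarmonic k = x
  generalize (harmonic (2 * k) : ℝ) = y
  push_cast
  rw [show 6 * (k : ℝ) + 3 = 3 * (2 * k + 1) by ring]
  field_simp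
  ring

theorem accelSeries_mixed (k : ℕ) :
    accelSeries (fun j m => 1 / (2 * (m : ℝ) + 1) + harmonic m + harmonic j
        - 2 * oddHarmonic (m + j + 1) - 2 * oddHarmonic (m + 1))
      (fun _ m => 1 / (2 * (m : ℝ) + 1)) (fun _ _ => 0) k =
    accelTerm (2 * k) k / ((6 * k + 3) * (6 * k + 5)) *
      ((2 * (k : ℝ) + 1) * (11 * k + 8) *
        (harmonic k + harmonic (2 * k) - 2 * oddHarmonic (3 * k + 3) - 2 * oddHarmonic k)
        + 2 * (3 * k + 2) / (2 * k + 1)) := by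
  have e1 : k + 2 * k + 1 = 3 * k + 1 := by ring
  have e2 : k + 1 + 2 * k + 1 = 3 * k + 1 + 1 := by ring
  have e3 : k + 1 + (2 * k + 1) + 1 = 3 * k + 1 + 1 + 1 := by ring
  have e4 : 3 * k + 3 = 3 * k + 1 + 1 + 1 := by ring
  rw [accelSeries_eq]
  simp only [e1, e2, e3, e4]
  simp only [oddHarmonic_succ _, harmonic_succ_real]
  have h2 : 2 * (k : ℝ) + 1 ≠ 0 := by positivity
  have h3 : 6 * (k : ℝ) + 5 ≠ 0 := by positivity
  have h4 : 2 * ((k : ℝ) + 1) + 1 ≠ 0 := by positivity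
  have h5 : (k : ℝ) + 1 ≠ 0 := by positivity
  generalize accelTerm (2 * k) k = D
  generalize oddHarmonic k = x
  generalize oddHarmonic (3 * k) = x'
  generalize (harmonic (2 * k) : ℝ) = y
  generalize (harmonic k : ℝ) = y'
  push_cast
  rw [show 6 * (k : ℝ) + 3 = 3 * (2 * k + 1) by ring,
    show 2 * (3 * (k : ℝ)) + 1 = 6 * k + 1 by ring,
    show 2 * (3 * (k : ℝ) + 1) + 1 = 3 * (2 * k + 1) by ring,
    show 2 * (3 * (k : ℝ) + 2) + 1 = 6 * k + 5 by ring]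
  field_simp
  ring

theorem accelSeries_window (k : ℕ) :
    accelSeries (fun j m => harmonic m - 1 / (2 * (m : ℝ) + 1) + oddWindow j m)
      (fun j m => -(1 / (2 * (m : ℝ) + 1)) + 2 * (1 / (2 * (m : ℝ) - 2 * j - 1)))
      (fun j m => 1 / (2 * (m : ℝ) - 2 * j - 1)) k =
    accelTerm (2 * k) k / ((6 * k + 3) * (6 * k + 5)) *
      ((2 * (k : ℝ) + 1) * (11 * k + 8) * harmonic k +
        (6 * k + 5) * (4 * k + 1) / (2 * k + 1)) := by
  rw [accelSeries_eq]
  have h1 := two_mul_sub_one_ne_zero k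
  have h2 : 2 * (k : ℝ) + 1 ≠ 0 := by positivity
  have h3 : 6 * (k : ℝ) + 5 ≠ 0 := by positivity
  have h4 : 2 * (k : ℝ) + 3 ≠ 0 := by positivity
  have h5 : (k : ℝ) + 1 ≠ 0 := by positivity
  simp only [oddWindow_succ_left, oddWindow_succ_right, oddWindow_diagonal, harmonic_succ_real]
  generalize accelTerm (2 * k) k = D
  generalize (harmonic k : ℝ) = y
  push_cast
  rw [show 2 * (k : ℝ) + 1 - 2 * (2 * k) = -(2 * k - 1) by ring,
    show 2 * ((k : ℝ) + 1) - 2 * (2 * k) - 1 = -(2 * k - 1) by ring,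
    show 2 * ((k : ℝ) + 1) - 2 * (2 * k + 1) - 1 = -(2 * k + 1) by ring,
    show 2 * ((k : ℝ) + 1) + 1 = 2 * k + 3 by ring,
    show 6 * (k : ℝ) + 3 = 3 * (2 * k + 1) by ring, div_neg, div_neg]
  field_simp
  ring

/-- Both sides satisfy the same first-order recurrence in `k`; the induction is run on the factorial
form, cleared of binomial denominators. -/
theorem choose_quotient_eq (k : ℕ) :
    (16 : ℝ) ^ k * (Nat.choose (4 * k) (2 * k) : ℝ) /
        ((Nat.choose (3 * k) k : ℝ) * (Nat.choose (6 * k) (3 * k) : ℝ)) =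
      (6 * k + 1) * accelTerm (2 * k) k := by
  rw [Nat.cast_choose ℝ (by omega : 2 * k ≤ 4 * k), Nat.cast_choose ℝ (by omega : k ≤ 3 * k),
    Nat.cast_choose ℝ (by omega : 3 * k ≤ 6 * k), show 4 * k - 2 * k = 2 * k by omega,
    show 3 * k - k = 2 * k by omega, show 6 * k - 3 * k = 3 * k by omega]
  have hf : ∀ n : ℕ, (n.factorial : ℝ) ≠ 0 := fun n => by exact_mod_cast n.factorial_ne_zero
  have key : (16 : ℝ) ^ k * ((4 * k).factorial : ℝ) * (k.factorial : ℝ) * ((3 * k).factorial : ℝ) =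
      (6 * k + 1) * accelTerm (2 * k) k * ((2 * k).factorial : ℝ) * ((6 * k).factorial : ℝ) := by
    induction k with
    | zero => simp [accelTerm]
    | succ k ih =>
      rw [accelTerm_diagonal, show 4 * (k + 1) = 4 * k + 1 + 1 + 1 + 1 by ring,
        show 3 * (k + 1) = 3 * k + 1 + 1 + 1 by ring, show 2 * (k + 1) = 2 * k + 1 + 1 by ring,
        show 6 * (k + 1) = 6 * k + 1 + 1 + 1 + 1 + 1 + 1 by ring]
      simp only [Nat.factorial_succ, pow_succ]
      push_cast
      have h1 : 2 * (k : ℝ) + 1 ≠ 0 := by positivity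
      have h3 : 6 * (k : ℝ) + 5 ≠ 0 := by positivity
      have h4 : 6 * (k : ℝ) + 7 ≠ 0 := by positivity
      have e : (16 : ℝ) ^ k * ((4 * k).factorial : ℝ) * (k.factorial : ℝ) *
          ((3 * k).factorial : ℝ) * (16 * ((4 * (k : ℝ) + 1) * (4 * k + 2) * (4 * k + 3) *
          (4 * k + 4)) * (k + 1) * ((3 * k + 1) * (3 * k + 2) * (3 * k + 3))) =
          (6 * k + 1) * accelTerm (2 * k) k * ((2 * k).factorial : ℝ) * ((6 * k).factorial : ℝ) *
          (16 * ((4 * (k : ℝ) + 1) * (4 * k + 2) * (4 * k + 3) *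
          (4 * k + 4)) * (k + 1) * ((3 * k + 1) * (3 * k + 2) * (3 * k + 3))) := by rw [ih]
      rw [show 6 * (k : ℝ) + 3 = 3 * (2 * k + 1) by ring]
      refine Eq.trans (Eq.trans ?_ e) ?_
      · ring
      · generalize ((2 * k).factorial : ℝ) = x
        generalize ((6 * k).factorial : ℝ) = y
        generalize accelTerm (2 * k) k = D
        field_simp
        ring
  have a := hf (2 * k)
  have b := hf (3 * k)
  have c := hf (6 * k)
  have d := hf k
  field_simp
  linarith

/-! ### Values of the accelerated series -/

theorem tendsto_accelSeries {h p s : ℕ → ℕ → ℝ} (hp : IsPerturbation h p s) {v : ℝ}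
    (hv : Filter.Tendsto (fun N : ℕ => ∑ m ∈ Finset.range N, accelTerm 0 m * h 0 m)
      Filter.atTop (nhds v)) :
    Filter.Tendsto (fun K : ℕ => ∑ k ∈ Finset.range K, accelSeries h p s k)
      Filter.atTop (nhds v) := by
  have h4 : Filter.Tendsto (fun K : ℕ => 4 * K) Filter.atTop Filter.atTop :=
    Filter.tendsto_id.const_mul_atTop' (by norm_num)
  have := (hv.comp h4).sub hp.tendsto_sub
  rw [sub_zero] at this
  exact this.congr fun K => by simp

theorem tendsto_sum_harmonic_catalan : Filter.Tendsto
    (fun N : ℕ => ∑ n ∈ Finset.range N, (-1) ^ n * (harmonic n : ℝ) / (2 * (n : ℝ) + 1))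
    Filter.atTop (nhds (catalanConstant - Real.pi / 2 * Real.log 2)) := by
  have := tendsto_sum_harmonic
  rwa [integral_log_one_add_sq_div, neg_sub] at this

theorem tendsto_sum_oddHarmonic_catalan : Filter.Tendsto
    (fun N : ℕ => ∑ n ∈ Finset.range N, (-1) ^ n * oddHarmonic (n + 1) / (2 * (n : ℝ) + 1))
    Filter.atTop (nhds (catalanConstant / 2 + Real.pi / 8 * Real.log 2)) := by
  have := tendsto_sum_oddHarmonic
  rw [integral_mul_arctan_div, integral_log_one_add_sq_div] at this
  convert this using 2
  ring

theorem tendsto_accelSeries_odd : Filter.Tendsto (fun K : ℕ => ∑ k ∈ Finset.range K,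
    accelSeries (fun j m => 4 * oddHarmonic m + 2 * (1 / (2 * (m : ℝ) + 1)) - harmonic j)
      (fun _ m => -2 * (1 / (2 * (m : ℝ) + 1))) (fun _ _ => 0) k)
    Filter.atTop (nhds (Real.pi / 2 * Real.log 2)) := by
  refine tendsto_accelSeries isPerturbation_odd ?_
  have := (tendsto_sum_oddHarmonic_catalan.const_mul 4).sub (tendsto_sum_catalan.const_mul 2)
  simp only [Finset.mul_sum, ← Finset.sum_sub_distrib] at this
  convert this using 3
  · rename_i m _
    have h1 : 2 * (m : ℝ) + 1 ≠ 0 := by positivity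
    simp only [accelTerm, oddHarmonic_succ, harmonic_zero, Rat.cast_zero]
    field_simp
    ring
  · ring

theorem tendsto_accelSeries_mixed : Filter.Tendsto (fun K : ℕ => ∑ k ∈ Finset.range K,
    accelSeries (fun j m => 1 / (2 * (m : ℝ) + 1) + harmonic m + harmonic j
        - 2 * oddHarmonic (m + j + 1) - 2 * oddHarmonic (m + 1))
      (fun _ m => 1 / (2 * (m : ℝ) + 1)) (fun _ _ => 0) k)
    Filter.atTop (nhds (-(Real.pi * Real.log 2))) := by
  refine tendsto_accelSeries isPerturbation_mixed ?_
  have := (tendsto_sum_catalan.add tendsto_sum_harmonic_catalan).sub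
    (tendsto_sum_oddHarmonic_catalan.const_mul 4)
  simp only [Finset.mul_sum, ← Finset.sum_sub_distrib, ← Finset.sum_add_distrib] at this
  convert this using 3
  · rename_i m _
    have h1 : 2 * (m : ℝ) + 1 ≠ 0 := by positivity
    simp only [accelTerm, add_zero, harmonic_zero, Rat.cast_zero]
    field_simp
    ring
  · ring

theorem tendsto_accelSeries_window : Filter.Tendsto (fun K : ℕ => ∑ k ∈ Finset.range K,
    accelSeries (fun j m => harmonic m - 1 / (2 * (m : ℝ) + 1) + oddWindow j m)
      (fun j m => -(1 / (2 * (m : ℝ) + 1)) + 2 * (1 / (2 * (m : ℝ) - 2 * j - 1)))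
      (fun j m => 1 / (2 * (m : ℝ) - 2 * j - 1)) k)
    Filter.atTop (nhds (2 * catalanConstant - Real.pi / 2 * Real.log 2)) := by
  refine tendsto_accelSeries isPerturbation_window ?_
  have := tendsto_sum_catalan.add tendsto_sum_harmonic_catalan
  simp only [← Finset.sum_add_distrib] at this
  convert this using 3
  · rename_i m _
    have h1 : 2 * (m : ℝ) + 1 ≠ 0 := by positivity
    simp only [accelTerm, oddWindow, zero_add, Finset.sum_range_one, Nat.cast_zero, sub_zero]
    field_simp
    ring
  · ring

/-! ### Return to the stated summands -/

theorem hasSum_pnat_of_tendsto {f : ℕ+ → ℝ} {g : ℕ → ℝ} {v : ℝ}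
    (hfg : ∀ k : ℕ, f k.succPNat = g k) (hg : ∀ k, 0 ≤ g k)
    (h : Filter.Tendsto (fun K : ℕ => ∑ k ∈ Finset.range K, g k) Filter.atTop (nhds v)) :
    HasSum f v := by
  rw [← Equiv.pnatEquivNat.symm.hasSum_iff]
  have : f ∘ Equiv.pnatEquivNat.symm = g := funext hfg
  rw [this]
  -- Nonnegativity upgrades convergence of the partial sums to unconditional summability.
  exact (hasSum_iff_tendsto_nat_of_nonneg hg v).mpr h

/-- After the shift `k ↦ k + 1`, the diagonal ratio cancels all the linear factors except
`(6k+3)(6k+5)`. The 8 comes from `(4k+2)(4k+4) = 8(2k+1)(k+1)`. -/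
theorem summand_eq (k : ℕ) (X : ℝ) :
    (16 : ℝ) ^ (k + 1) * (Nat.choose (4 * (k + 1)) (2 * (k + 1)) : ℝ) * X /
      (((k + 1 : ℕ) : ℝ) * (4 * ((k + 1 : ℕ) : ℝ) - 1) * (4 * ((k + 1 : ℕ) : ℝ) - 3) *
        (Nat.choose (3 * (k + 1)) (k + 1) : ℝ) * (Nat.choose (6 * (k + 1)) (3 * (k + 1)) : ℝ)) =
    8 * (accelTerm (2 * k) k / ((6 * k + 3) * (6 * k + 5)) * X) := by
  have h := choose_quotient_eq (k + 1)
  rw [accelTerm_diagonal] at h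
  have e : ∀ a b c d e f g : ℝ, a * b * X / (c * d * e * f * g) =
      a * b / (f * g) * (X / (c * d * e)) := fun a b c d e f g => by
    rw [div_mul_div_comm]; ring
  rw [e, h]
  push_cast
  have h1 : 2 * (k : ℝ) + 1 ≠ 0 := by positivity
  have h2 : 6 * (k : ℝ) + 3 ≠ 0 := by positivity
  have h3 : 6 * (k : ℝ) + 5 ≠ 0 := by positivity
  have h4 : 6 * (k : ℝ) + 7 ≠ 0 := by positivity
  have h5 : (k : ℝ) + 1 ≠ 0 := by positivity
  have h6 : 4 * (k : ℝ) + 1 ≠ 0 := by positivity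
  have h7 : 4 * (k : ℝ) + 3 ≠ 0 := by positivity
  rw [show 4 * ((k : ℝ) + 1) - 1 = 4 * k + 3 by ring, show 4 * ((k : ℝ) + 1) - 3 = 4 * k + 1 by ring,
    show 6 * ((k : ℝ) + 1) + 1 = 6 * k + 7 by ring]
  generalize accelTerm (2 * k) k = D
  rw [show 6 * (k : ℝ) + 3 = 3 * (2 * k + 1) by ring]
  field_simp
  ring

theorem theorem1p14 :
    HasSum
      (fun k : ℕ+ =>
        (16 : ℝ) ^ (k : ℕ) * (Nat.choose (4 * (k : ℕ)) (2 * (k : ℕ)) : ℝ) *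
            (polyQ (k : ℝ) * (harmonic ((k : ℕ) - 1) : ℝ) +
              (6 * (k : ℝ) - 1) * (4 * (k : ℝ) - 3) / (2 * (k : ℝ) - 1)) /
          ((k : ℝ) * (4 * (k : ℝ) - 1) * (4 * (k : ℝ) - 3) *
            (Nat.choose (3 * (k : ℕ)) (k : ℕ) : ℝ) *
            (Nat.choose (6 * (k : ℕ)) (3 * (k : ℕ)) : ℝ)))
      (16 * catalanConstant - 4 * Real.pi * Real.log 2) ∧
    HasSum
      (fun k : ℕ+ =>
        (16 : ℝ) ^ (k : ℕ) * (Nat.choose (4 * (k : ℕ)) (2 * (k : ℕ)) : ℝ) *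
            (polyQ (k : ℝ) * (harmonic (2 * (k : ℕ) - 1) : ℝ) +
              (6 * (k : ℝ) - 1) * ((k : ℝ) - 3) / (6 * (k : ℝ) - 3)) /
          ((k : ℝ) * (4 * (k : ℝ) - 1) * (4 * (k : ℝ) - 3) *
            (Nat.choose (3 * (k : ℕ)) (k : ℕ) : ℝ) *
            (Nat.choose (6 * (k : ℕ)) (3 * (k : ℕ)) : ℝ)))
      (4 / 3 * (8 * catalanConstant - Real.pi * Real.log 2)) ∧
    HasSum
      (fun k : ℕ+ =>
        (16 : ℝ) ^ (k : ℕ) * (Nat.choose (4 * (k : ℕ)) (2 * (k : ℕ)) : ℝ) *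
            (polyQ (k : ℝ) *
                (2 * (harmonic (6 * (k : ℕ) - 1) : ℝ) - (harmonic (3 * (k : ℕ) - 1) : ℝ)) +
              4 * (18 * (k : ℝ) ^ 2 - 20 * (k : ℝ) + 3) / (6 * (k : ℝ) - 3)) /
          ((k : ℝ) * (4 * (k : ℝ) - 1) * (4 * (k : ℝ) - 3) *
            (Nat.choose (3 * (k : ℕ)) (k : ℕ) : ℝ) *
            (Nat.choose (6 * (k : ℕ)) (3 * (k : ℕ)) : ℝ)))
      (4 / 3 * (16 * catalanConstant + Real.pi * Real.log 2)) := by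
  have hHnn := harmonic_nonneg_real
  have hD := fun k : ℕ => (accelTerm_diagonal_pos_le k).1
  refine ⟨?_, ?_, ?_⟩
  · refine hasSum_pnat_of_tendsto (g := fun k : ℕ =>
      8 * (accelTerm (2 * k) k / ((6 * k + 3) * (6 * k + 5)) *
        ((2 * (k : ℝ) + 1) * (11 * k + 8) * harmonic k +
          (6 * k + 5) * (4 * k + 1) / (2 * k + 1)))) (fun k => ?_) (fun k => ?_) ?_
    · simp only [Nat.succPNat_coe, Nat.succ_eq_add_one, summand_eq, Nat.add_sub_cancel]
      unfold polyQ
      have h2 : 2 * (k : ℝ) + 1 ≠ 0 := by positivity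
      push_cast
      rw [show 2 * ((k : ℝ) + 1) - 1 = 2 * k + 1 by ring]
      ring
    · have := hHnn k
      have := hD k
      positivity
    · have := tendsto_accelSeries_window.const_mul 8
      simp only [Finset.mul_sum, accelSeries_window] at this
      convert this using 2
      ring
  · refine hasSum_pnat_of_tendsto (g := fun k : ℕ =>
      8 * (accelTerm (2 * k) k / ((6 * k + 3) * (6 * k + 5)) *
        ((2 * (k : ℝ) + 1) * (11 * k + 8) * harmonic (2 * k + 1) +
          (6 * k + 5) * (k - 2) / (6 * k + 3)))) (fun k => ?_) (fun k => ?_) ?_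
    · have e : 2 * (k + 1) - 1 = 2 * k + 1 := by omega
      simp only [Nat.succPNat_coe, Nat.succ_eq_add_one, summand_eq, e]
      unfold polyQ
      push_cast
      rw [show 6 * ((k : ℝ) + 1) - 3 = 6 * k + 3 by ring]
      ring
    · have h1 : (1 : ℝ) ≤ harmonic (2 * k + 1) := by
        induction k with
        | zero => simp
        | succ k ih =>
          rw [show 2 * (k + 1) + 1 = 2 * k + 1 + 1 + 1 by ring, harmonic_succ_real,
            harmonic_succ_real]
          have : (0 : ℝ) ≤ 1 / ((2 * k + 1 : ℕ) + 1) := by positivity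
          have : (0 : ℝ) ≤ 1 / ((2 * k + 1 + 1 : ℕ) + 1) := by positivity
          linarith
      -- The rational part is negative for `k < 2`; the bound -8 matches the least value 8 of
      -- `(2k+1)(11k+8)`, with `H_{2k+1} ≥ 1`.
      have h2 : (-8 : ℝ) ≤ (6 * k + 5) * (k - 2) / (6 * k + 3) := by
        rw [le_div_iff₀ (by positivity)]
        have := Nat.cast_nonneg (α := ℝ) k
        nlinarith [sq_nonneg (k : ℝ)]
      have h3 : (8 : ℝ) ≤ (2 * (k : ℝ) + 1) * (11 * k + 8) * harmonic (2 * k + 1) := by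
        have := Nat.cast_nonneg (α := ℝ) k
        have h4 : (8 : ℝ) ≤ (2 * (k : ℝ) + 1) * (11 * k + 8) := by nlinarith
        nlinarith
      have := hD k
      have h5 : 0 ≤ (2 * (k : ℝ) + 1) * (11 * k + 8) * harmonic (2 * k + 1) +
          (6 * k + 5) * (k - 2) / (6 * k + 3) := by linarith
      positivity
    -- The coefficients solve `2/3 H_k + 1/3 (4 O_k - H_{2k}) = H_{2k}`, using `H_{2k} = O_k +
    -- H_k/2`.
    · have := ((tendsto_accelSeries_window.const_mul (2 / 3)).add
        (tendsto_accelSeries_odd.const_mul (1 / 3))).const_mul 8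
      simp only [Finset.mul_sum, ← Finset.sum_add_distrib, accelSeries_window,
        accelSeries_odd] at this
      have hv : 8 * (2 / 3 * (2 * catalanConstant - Real.pi / 2 * Real.log 2) +
          1 / 3 * (Real.pi / 2 * Real.log 2)) =
          4 / 3 * (8 * catalanConstant - Real.pi * Real.log 2) := by ring
      rw [hv] at this
      refine this.congr fun K => Finset.sum_congr rfl fun k _ => ?_
      rw [harmonic_succ_real, harmonic_two_mul]
      have h2 : 2 * (k : ℝ) + 1 ≠ 0 := by positivity
      have h3 : 6 * (k : ℝ) + 5 ≠ 0 := by positivity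
      generalize accelTerm (2 * k) k = D
      push_cast
      rw [show 6 * (k : ℝ) + 3 = 3 * (2 * k + 1) by ring]
      field_simp
      ring
  · refine hasSum_pnat_of_tendsto (g := fun k : ℕ =>
      8 * (accelTerm (2 * k) k / ((6 * k + 3) * (6 * k + 5)) *
        ((2 * (k : ℝ) + 1) * (11 * k + 8) * (2 * oddHarmonic (3 * k + 3)) +
          4 * (18 * k ^ 2 + 16 * k + 1) / (6 * k + 3)))) (fun k => ?_) (fun k => ?_) ?_
    · have e1 : 6 * (k + 1) - 1 = 6 * k + 5 := by omega
      have e2 : 3 * (k + 1) - 1 = 3 * k + 2 := by omega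
      have hh : 2 * (harmonic (6 * k + 5) : ℝ) - harmonic (3 * k + 2) =
          2 * oddHarmonic (3 * k + 3) := by
        have ha := harmonic_two_mul (3 * k + 3)
        rw [show 2 * (3 * k + 3) = 6 * k + 5 + 1 by ring, harmonic_succ_real (6 * k + 5),
          show (harmonic (3 * k + 3) : ℝ) = harmonic (3 * k + 2 + 1) from rfl,
          harmonic_succ_real (3 * k + 2)] at ha
        have hb : 1 / (((6 * k + 5 : ℕ) : ℝ) + 1) = 1 / (((3 * k + 2 : ℕ) : ℝ) + 1) / 2 := by
          push_cast
          have h1 : 3 * (k : ℝ) + 2 + 1 ≠ 0 := by positivity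
          rw [show 6 * (k : ℝ) + 5 + 1 = 2 * (3 * k + 2 + 1) by ring]
          field_simp
        linarith
      simp only [Nat.succPNat_coe, Nat.succ_eq_add_one, summand_eq, e1, e2, hh]
      unfold polyQ
      push_cast
      rw [show 6 * ((k : ℝ) + 1) - 3 = 6 * k + 3 by ring]
      ring
    · have := oddHarmonic_nonneg (3 * k + 3)
      have := hD k
      positivity
    -- This combination cancels `H_k` and `O_k`, leaving only `2 O_{3k+3}`.
    · have := (((tendsto_accelSeries_window.const_mul (4 / 3)).sub
        (tendsto_accelSeries_odd.const_mul (1 / 3))).sub tendsto_accelSeries_mixed).const_mul 8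
      simp only [Finset.mul_sum, ← Finset.sum_sub_distrib, accelSeries_window,
        accelSeries_odd, accelSeries_mixed] at this
      have hv : 8 * (4 / 3 * (2 * catalanConstant - Real.pi / 2 * Real.log 2) -
          1 / 3 * (Real.pi / 2 * Real.log 2) - -(Real.pi * Real.log 2)) =
          4 / 3 * (16 * catalanConstant + Real.pi * Real.log 2) := by ring
      rw [hv] at this
      refine this.congr fun K => Finset.sum_congr rfl fun k _ => ?_
      rw [harmonic_two_mul]
      have h2 : 2 * (k : ℝ) + 1 ≠ 0 := by positivity
      have h3 : 6 * (k : ℝ) + 5 ≠ 0 := by positivity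
      generalize accelTerm (2 * k) k = D
      rw [show 6 * (k : ℝ) + 3 = 3 * (2 * k + 1) by ring]
      field_simp
      ring
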